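/- **Theorem 1.** Let $n\ge 1$, let $C$ be a convex body in $\mathbb{R}^n$ (a compact convex set with non-empty interior) and let $T$ be a regular $n$-dimensional solid simplex in $\mathbb{R}^n$, of any side length. Write $|K|$ for the $n$-dimensional volume of a convex body $K$ and $|\partial K|$ for its surface area, i.e. the $(n-1)$-dimensional Hausdorff measure of its boundary, normalised to agree with Lebesgue measure on $(n-1)$-dimensional Euclidean spaces. Then there is an invertible affine map $\varphi:\mathbb{R}^n\to\mathbb{R}^n$ such that the affine image $\widetilde C=\varphi(C)$ satisfies $$|\widetilde C| = |T| \qquad\text{and}\qquad |\partial\widetilde C|\le|\partial T| .$$ In particular, the isoperimetric ratio of $\widetilde C$ is no larger than that of a regular simplex: $$\frac{|\partial \widetilde C|}{|\widetilde C|^{(n-1)/n}}\le\frac{|\partial T|}{|T|^{(n-1)/n}} .$$ -/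

import Mathlib

open MeasureTheory

noncomputable section

/-- The surface area of a set `K` in `ℝⁿ`: the `(n - 1)`-dimensional area of its topological
boundary. Here `μHE[n - 1]` is the `(n - 1)`-dimensional Hausdorff measure, normalised so that it
agrees with Lebesgue measure on `(n - 1)`-dimensional Euclidean spaces (for `n = 1` it counts
points). -/
def surfaceArea {n : ℕ} (K : Set (EuclideanSpace ℝ (Fin n))) : ENNReal :=
  μHE[n - 1] (frontier K)

/-- The isoperimetric ratio `|∂K| / |K| ^ ((n - 1) / n)` of a set `K` in `ℝⁿ`. -/
def isoperimetricRatio {n : ℕ} (K : Set (EuclideanSpace ℝ (Fin n))) : ENNReal :=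
  surfaceArea K / (volume K) ^ (((n : ℝ) - 1) / (n : ℝ))

end

/-!
The reverse isoperimetric inequality follows from two estimates for a convex body `C` placed so that
the unit ball `B` has maximal volume among the ellipsoids in `C`.

*Surface area.* Since `B ⊆ C`, the surface area of `C` is at most `n |C|`
(`surfaceArea_le_of_closedBall_subset`). For a polyhedron this is the decomposition into cones with
apex `0` over the facets, each of height at least `1`. The general case follows by approximating `C`
from outside by polyhedra, as the nearest-point projection onto `C` does not increase Hausdorff
measure and maps the boundary of a larger body onto that of `C`
(`euclideanHausdorffMeasure_frontier_mono`). For a regular simplex with inradius `1` all heights are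
equal to `1`, and the surface area is at least `n` times the volume (`le_surfaceArea_polyhedron`).

*Volume.* By John's theorem (`exists_john_decomposition`) there are contact points `uᵢ` and weights
`cᵢ ≥ 0` with `∑ cᵢ uᵢ = 0` and `∑ cᵢ uᵢ ⊗ uᵢ = I`, and `C` lies in the half-spaces `⟪uᵢ, x⟫ ≤ 1`.
Following Ball, the `uᵢ` are lifted to unit vectors `vᵢ` of `ℝⁿ⁺¹` with `∑ dᵢ vᵢ ⊗ vᵢ = I`. The
integral of `exp (-∑ dᵢ ⟪vᵢ, y⟫)` over the cone where all `⟪vᵢ, y⟫` are positive is a constant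
depending only on `n` times the volume cut out by the half-spaces (`lintegral_cone_eq`). The
geometric Brascamp–Lieb inequality, proved here for exponential densities by transport to a Gaussian
(`lintegral_exp_neg_sum_le_one`), bounds it by `1`, with equality if the `vᵢ` form an orthonormal
basis, which is the case of the regular simplex. Hence `|C|` is at most the volume of the regular
simplex with inradius `1` (`volume_le_volume_polyhedron`).

A dilation of `C` now makes the volumes equal; its factor is at least the inradius of the given
simplex, and the estimates on the surface areas combine to the claim.
-/

/-! ### Surface area of nested convex bodies and volume of cones -/

/-- Pushing a boundary point of a convex set out along a normal until it meets the boundary of a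
larger compact set shows that the boundary of the small set is contained in the image of the
boundary of the large one under the nearest-point projection, which is a contraction. -/
theorem euclideanHausdorffMeasure_frontier_mono {E : Type*} [NormedAddCommGroup E]
    [InnerProductSpace ℝ E] [FiniteDimensional ℝ E] [MeasurableSpace E] [BorelSpace E]
    {C P : Set E} (hC : Convex ℝ C) (hCc : IsClosed C) (hCi : (interior C).Nonempty)
    (hP : IsCompact P) (hCP : C ⊆ P) (d : ℕ) :
    μHE[d] (frontier C) ≤ μHE[d] (frontier P) := by
  have hne : C.Nonempty := hCi.mono interior_subset
  have hproj : ∀ x : E, ∃ y ∈ C, ∀ z ∈ C, inner ℝ (x - y) (z - y) ≤ 0 := by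
    intro x
    obtain ⟨y, hy, h⟩ := exists_norm_eq_iInf_of_complete_convex hne hCc.isComplete hC x
    exact ⟨y, hy, (norm_eq_iInf_iff_real_inner_le_zero hC hy).1 h⟩
  choose p hpC hp using hproj
  have hlip : LipschitzWith 1 p := by
    refine LipschitzWith.of_dist_le_mul fun x y => ?_
    rw [dist_eq_norm, dist_eq_norm, NNReal.coe_one, one_mul]
    have h1 := hp x (p y) (hpC y)
    have h2 := hp y (p x) (hpC x)
    have h3 : ‖p x - p y‖ * ‖p x - p y‖ ≤ inner ℝ (x - y) (p x - p y) := by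
      rw [← real_inner_self_eq_norm_mul_norm]
      have e1 : inner ℝ (x - p x) (p y - p x) = - inner ℝ (x - p x) (p x - p y) := by
        rw [← inner_neg_right, neg_sub]
      have e2 : inner ℝ (x - y) (p x - p y) = inner ℝ (x - p x) (p x - p y)
          - inner ℝ (y - p y) (p x - p y) + inner ℝ (p x - p y) (p x - p y) := by
        rw [← inner_sub_left, ← inner_add_left]; congr 1; abel
      linarith
    have h4 := h3.trans (real_inner_le_norm _ _)
    by_contra! hlt
    have : 0 < ‖p x - p y‖ := (norm_nonneg _).trans_lt hlt
    nlinarith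
  -- `w` is an outer normal at `z`; the last point of the ray `z + s w` in `P` projects back to `z`.
  have hsub : frontier C ⊆ p '' frontier P := by
    intro z hz
    have hzC : z ∈ C := hCc.frontier_subset hz
    obtain ⟨f, hf⟩ := geometric_hahn_banach_open_point hC.interior isOpen_interior hz.2
    set w := (InnerProductSpace.toDual ℝ E).symm f with hw
    have hfw : ∀ x, f x = inner ℝ w x := fun x => by simp [hw]
    have hle : ∀ c ∈ C, inner ℝ w c ≤ inner ℝ w z := by
      intro c hc
      have hcl : c ∈ closure (interior C) := by
        rw [hC.closure_interior_eq_closure_of_nonempty_interior hCi]; exact subset_closure hc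
      rw [← hfw, ← hfw]
      exact closure_minimal (fun x hx => (hf x hx).le) (isClosed_le f.continuous continuous_const) hcl
    have hw0 : w ≠ 0 := by
      intro h0
      obtain ⟨x, hx⟩ := hCi
      have := hf x hx
      simp [hfw, h0] at this
    have hcl : IsClosed {s : ℝ | z + s • w ∈ P} := hP.isClosed.preimage (by fun_prop)
    obtain ⟨R, hR⟩ := hP.isBounded.exists_norm_le
    have hbdd : BddAbove {s : ℝ | z + s • w ∈ P} := by
      refine ⟨(R + ‖z‖) / ‖w‖, fun s hs => ?_⟩
      rw [le_div_iff₀ (norm_pos_iff.2 hw0)]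
      have h1 := hR _ hs
      have h2 : ‖s • w‖ ≤ ‖z + s • w‖ + ‖z‖ := by
        simpa using norm_sub_le (z + s • w) z
      rw [norm_smul, Real.norm_eq_abs] at h2
      have h3 := mul_le_mul_of_nonneg_right (le_abs_self s) (norm_nonneg w)
      linarith
    have h0mem : (0 : ℝ) ∈ {s : ℝ | z + s • w ∈ P} := by simpa using hCP hzC
    set s := sSup {s : ℝ | z + s • w ∈ P} with hs
    have hsP : z + s • w ∈ P := hcl.csSup_mem ⟨0, h0mem⟩ hbdd
    have hs0 : 0 ≤ s := le_csSup hbdd h0mem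
    refine ⟨z + s • w, ⟨subset_closure hsP, fun hint => ?_⟩, ?_⟩
    · have ho : IsOpen {t : ℝ | z + t • w ∈ interior P} :=
        isOpen_interior.preimage (by fun_prop)
      obtain ⟨ε, hε, hb⟩ := Metric.isOpen_iff.1 ho s hint
      have hmem : s + ε / 2 ∈ Metric.ball s ε := by
        rw [Metric.mem_ball, Real.dist_eq, add_sub_cancel_left, abs_of_pos (by positivity)]
        linarith
      have := le_csSup hbdd (show s + ε / 2 ∈ {s : ℝ | z + s • w ∈ P} from
        interior_subset (s := P) (hb hmem))
      linarith
    · set q := p (z + s • w)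
      have h1 := hp (z + s • w) z hzC
      have h2 := hle q (hpC _)
      have h3 : inner ℝ (z + s • w - q) (z - q) =
          inner ℝ (z - q) (z - q) + s * (inner ℝ w z - inner ℝ w q) := by
        rw [← inner_sub_right, ← real_inner_smul_left, ← inner_add_left]
        congr 1; abel
      have h4 : 0 ≤ s * (inner ℝ w z - inner ℝ w q) := mul_nonneg hs0 (by linarith)
      have h5 : inner ℝ (z - q) (z - q) ≤ 0 := by linarith
      exact (sub_eq_zero.1 (real_inner_self_nonpos.1 h5)).symm
  calc μHE[d] (frontier C) ≤ μHE[d] (p '' frontier P) := measure_mono hsub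
    _ ≤ μHE[d] (frontier P) := by
      simp only [Measure.euclideanHausdorffMeasure_def, Measure.smul_apply]
      refine mul_le_mul_right ?_ _
      simpa using hlip.hausdorffMeasure_image_le (d := d) (by positivity) (frontier P)

open scoped Pointwise in
/-- The volume of the cone with apex `0` over a subset `F` of the hyperplane `⟪a, x⟫ = 1`, whose
distance from `0` is `1 / ‖a‖`. -/
theorem volume_cone {n : ℕ} (hn : 1 ≤ n) {a : EuclideanSpace ℝ (Fin n)} (ha : a ≠ 0)
    {F : Set (EuclideanSpace ℝ (Fin n))} (hF : MeasurableSet F) (hFa : ∀ x ∈ F, inner ℝ a x = 1) :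
    n * ‖a‖ₑ * volume {y | inner ℝ a y ∈ Set.Ioc (0 : ℝ) 1 ∧ (inner ℝ a y)⁻¹ • y ∈ F} =
      μHE[n - 1] F := by
  set K := {y | inner ℝ a y ∈ Set.Ioc (0 : ℝ) 1 ∧ (inner ℝ a y)⁻¹ • y ∈ F} with hK
  have hKm : MeasurableSet K := by
    have h1 : Measurable fun y : EuclideanSpace ℝ (Fin n) => inner ℝ a y := by fun_prop
    exact (h1 measurableSet_Ioc).inter ((h1.inv.smul measurable_id) hF)
  have hna : 0 < ‖a‖ := norm_pos_iff.2 ha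
  -- The section of the cone by the hyperplane `⟪a, y⟫ = t ‖a‖ ^ 2` is a dilate of `F`.
  have hslice : ∀ t : ℝ, (μHE[n - 1] (K ∩ AffineSubspace.mk' (t • a +ᵥ (0 : EuclideanSpace ℝ (Fin n))) (ℝ ∙ a)ᗮ)) =
      (Set.Ioc (0 : ℝ) (1 / ‖a‖ ^ 2)).indicator
        (fun t => ENNReal.ofReal ((t * ‖a‖ ^ 2) ^ (n - 1)) * μHE[n - 1] F) t := by
    intro t
    have hmem : ∀ y, y ∈ AffineSubspace.mk' (t • a +ᵥ (0 : EuclideanSpace ℝ (Fin n))) (ℝ ∙ a)ᗮ ↔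
        inner ℝ a y = t * ‖a‖ ^ 2 := by
      intro y
      rw [AffineSubspace.mem_mk', Submodule.mem_orthogonal_singleton_iff_inner_right]
      simp only [vadd_eq_add, add_zero, vsub_eq_sub, inner_sub_right, inner_smul_right,
        real_inner_self_eq_norm_sq, sub_eq_zero]
    have hiff : t ∈ Set.Ioc (0 : ℝ) (1 / ‖a‖ ^ 2) ↔ t * ‖a‖ ^ 2 ∈ Set.Ioc (0 : ℝ) 1 := by
      rw [Set.mem_Ioc, Set.mem_Ioc, le_div_iff₀ (by positivity)]
      constructor
      · rintro ⟨h, h'⟩; exact ⟨by positivity, h'⟩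
      · rintro ⟨h, h'⟩; exact ⟨pos_of_mul_pos_left h (by positivity), h'⟩
    by_cases ht : t ∈ Set.Ioc (0 : ℝ) (1 / ‖a‖ ^ 2)
    · rw [Set.indicator_of_mem ht]
      have ht' := hiff.1 ht
      have : K ∩ AffineSubspace.mk' (t • a +ᵥ (0 : EuclideanSpace ℝ (Fin n))) (ℝ ∙ a)ᗮ = (t * ‖a‖ ^ 2) • F := by
        ext y
        rw [Set.mem_smul_set_iff_inv_smul_mem₀ ht'.1.ne']
        constructor
        · rintro ⟨h1, h2⟩
          rw [← (hmem y).1 h2]; exact h1.2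
        · intro h
          have h2 : inner ℝ a y = t * ‖a‖ ^ 2 := by
            have := hFa _ h
            rw [inner_smul_right] at this
            rw [inv_mul_eq_one₀ ht'.1.ne'] at this
            exact this.symm
          exact ⟨⟨h2 ▸ ht', h2.symm ▸ h⟩, (hmem y).2 h2⟩
      rw [this, Measure.euclideanHausdorffMeasure_smul₀ _ ht'.1.ne', ENNReal.smul_def, smul_eq_mul,
        ENNReal.coe_pow, ENNReal.ofReal_pow ht'.1.le, ← enorm_eq_nnnorm, Real.enorm_of_nonneg ht'.1.le]
    · rw [Set.indicator_of_notMem ht]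
      convert measure_empty (μ := μHE[n - 1])
      refine Set.eq_empty_of_forall_notMem fun y hy => ht (hiff.2 ?_)
      rw [← (hmem y).1 hy.2]; exact hy.1.1
  have hvol := EuclideanGeometry.euclideanHausdorffMeasure_eq_lintegral
    (0 : EuclideanSpace ℝ (Fin n)) ha hKm
  simp only [finrank_euclideanSpace_fin, EuclideanSpace.euclideanHausdorffMeasure_eq_volume,
    hslice] at hvol
  have hint : ∫⁻ t in Set.Ioc (0 : ℝ) (1 / ‖a‖ ^ 2), ENNReal.ofReal ((t * ‖a‖ ^ 2) ^ (n - 1)) =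
      ENNReal.ofReal (1 / (n * ‖a‖ ^ 2)) := by
    rw [← ofReal_integral_eq_lintegral_ofReal]
    · rw [← intervalIntegral.integral_of_le (by positivity)]
      simp only [mul_pow]
      rw [intervalIntegral.integral_mul_const, integral_pow, Nat.cast_sub hn]
      congr 1
      obtain ⟨m, rfl⟩ : ∃ m, n = m + 1 := ⟨n - 1, by omega⟩
      simp only [Nat.add_sub_cancel]
      push_cast
      rw [sub_add_cancel, zero_pow (by simp), sub_zero, one_div_pow]
      field_simp
      ring
    · exact (Continuous.integrableOn_Icc (by fun_prop)).mono_set Set.Ioc_subset_Icc_self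
    · filter_upwards [ae_restrict_mem measurableSet_Ioc] with t ht
      have := ht.1
      positivity
  rw [lintegral_indicator measurableSet_Ioc, lintegral_mul_const _ (by fun_prop), hint] at hvol
  have hn0 : (0 : ℝ) < n := by exact_mod_cast hn
  rw [hvol, ← ofReal_norm, ← ENNReal.ofReal_natCast, ← mul_assoc, ← mul_assoc,
    ← ENNReal.ofReal_mul hn0.le, ← ENNReal.ofReal_mul (by positivity),
    ← ENNReal.ofReal_mul (by positivity)]
  convert one_mul _
  rw [ENNReal.ofReal_eq_one]
  field_simp

/-! ### Polyhedra and their facets -/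

/-- The polyhedron cut out by the half-spaces `⟪a i, x⟫ ≤ 1`. -/
def polyhedron {ι E : Type*} [NormedAddCommGroup E] [InnerProductSpace ℝ E] (a : ι → E) : Set E :=
  {x | ∀ i, inner ℝ (a i) x ≤ 1}

/-- The `i`-th facet of `polyhedron a`, without the points that already lie on an earlier facet, so
that distinct facets are disjoint. -/
def facet {m : ℕ} {E : Type*} [NormedAddCommGroup E] [InnerProductSpace ℝ E] (a : Fin m → E)
    (i : Fin m) : Set E :=
  {x | x ∈ polyhedron a ∧ inner ℝ (a i) x = 1 ∧ ∀ j < i, inner ℝ (a j) x < 1}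

/-- The cone with apex `0` over a facet, without its apex. -/
def facetCone {m : ℕ} {E : Type*} [NormedAddCommGroup E] [InnerProductSpace ℝ E] (a : Fin m → E)
    (i : Fin m) : Set E :=
  {y | inner ℝ (a i) y ∈ Set.Ioc (0 : ℝ) 1 ∧ (inner ℝ (a i) y)⁻¹ • y ∈ facet a i}

section Polyhedron

variable {m : ℕ} {E : Type*} [NormedAddCommGroup E] [InnerProductSpace ℝ E] (a : Fin m → E)

theorem isClosed_polyhedron {ι : Type*} (a : ι → E) : IsClosed (polyhedron a) := by
  simp only [polyhedron, Set.ofPred_forall]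
  exact isClosed_iInter fun i => isClosed_le (by fun_prop) continuous_const

theorem convex_polyhedron {ι : Type*} (a : ι → E) : Convex ℝ (polyhedron a) := by
  simp only [polyhedron, Set.ofPred_forall]
  exact convex_iInter fun i => convex_halfSpace_le (innerSL ℝ (a i)).isLinear 1

theorem measurableSet_facet [MeasurableSpace E] [BorelSpace E] [SecondCountableTopology E]
    (i : Fin m) : MeasurableSet (facet a i) := by
  have h : ∀ j, Measurable fun x : E => inner ℝ (a j) x := fun j => by fun_prop
  have hlt : MeasurableSet {x : E | ∀ j < i, inner ℝ (a j) x < 1} := by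
    have : {x : E | ∀ j < i, inner ℝ (a j) x < 1} = ⋂ j, ⋂ _ : j < i, {x | inner ℝ (a j) x < 1} := by
      ext x; simp
    rw [this]
    exact MeasurableSet.iInter fun j => MeasurableSet.iInter fun _ =>
      measurableSet_lt (h j) measurable_const
  exact (isClosed_polyhedron a).measurableSet.inter
    ((measurableSet_eq_fun (h i) measurable_const).inter hlt)

theorem measurableSet_facetCone [MeasurableSpace E] [BorelSpace E] [SecondCountableTopology E]
    (i : Fin m) : MeasurableSet (facetCone a i) := by
  have h1 : Measurable fun y : E => inner ℝ (a i) y := by fun_prop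
  exact (h1 measurableSet_Ioc).inter ((h1.inv.smul measurable_id) (measurableSet_facet a i))

theorem pairwise_disjoint_facet : Pairwise (Function.onFun Disjoint (facet a)) := by
  intro i j hij
  refine Set.disjoint_left.2 fun x hi hj => ?_
  rcases lt_or_gt_of_ne hij with h | h
  · exact (hj.2.2 i h).ne hi.2.1
  · exact (hi.2.2 j h).ne hj.2.1

theorem mem_frontier_polyhedron {i : Fin m} {x : E} (hx : x ∈ polyhedron a)
    (hi : inner ℝ (a i) x = 1) : x ∈ frontier (polyhedron a) := by
  rw [(isClosed_polyhedron a).frontier_eq]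
  refine ⟨hx, fun hint => ?_⟩
  have hc : ContinuousAt (fun t : ℝ => t • x) 1 := by fun_prop
  have h1 : ∀ᶠ t in nhds (1 : ℝ), t • x ∈ polyhedron a :=
    hc.eventually (by simpa using mem_interior_iff_mem_nhds.1 hint)
  obtain ⟨t, ht, ht1⟩ := ((h1.filter_mono nhdsWithin_le_nhds).and
    (self_mem_nhdsWithin (s := Set.Ioi (1 : ℝ)))).exists
  have := ht i
  rw [inner_smul_right, hi, mul_one] at this
  exact absurd this (not_le.2 ht1)

theorem iUnion_facet : ⋃ i, facet a i = frontier (polyhedron a) := by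
  ext x
  rw [(isClosed_polyhedron a).frontier_eq, Set.mem_iUnion]
  constructor
  · rintro ⟨i, hx, hi, -⟩
    exact ((isClosed_polyhedron a).frontier_eq ▸ mem_frontier_polyhedron a hx hi)
  · rintro ⟨hx, hint⟩
    have hex : ∃ i, inner ℝ (a i) x = 1 := by
      by_contra! h
      refine hint (mem_interior.2 ⟨{y | ∀ i, inner ℝ (a i) y < 1}, fun y hy i => (hy i).le, ?_,
        fun i => (hx i).lt_of_ne (h i)⟩)
      simp only [Set.ofPred_forall]
      exact isOpen_iInter_of_finite fun i => isOpen_lt (by fun_prop) continuous_const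
    classical
    let s := Finset.univ.filter fun i => inner ℝ (a i) x = 1
    have hs : s.Nonempty := by
      obtain ⟨i, hi⟩ := hex
      exact ⟨i, by simpa [s] using hi⟩
    refine ⟨s.min' hs, hx, by simpa [s] using s.min'_mem hs, fun j hj => (hx j).lt_of_ne fun h => ?_⟩
    exact absurd (s.min'_le j (by simpa [s] using h)) (not_le.2 hj)

theorem facetCone_subset (i : Fin m) : facetCone a i ⊆ polyhedron a := by
  rintro y ⟨⟨h0, h1⟩, h2⟩ j
  have := h2.1 j
  rw [inner_smul_right, inv_mul_le_iff₀ h0, mul_one] at this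
  exact this.trans h1

theorem pairwise_disjoint_facetCone : Pairwise (Function.onFun Disjoint (facetCone a)) := by
  intro i j hij
  refine Set.disjoint_left.2 fun x hi hj => ?_
  have h1 := hj.2.1 i
  have h2 := hi.2.1 j
  rw [inner_smul_right, inv_mul_le_iff₀ hi.1.1, mul_one] at h2
  rw [inner_smul_right, inv_mul_le_iff₀ hj.1.1, mul_one] at h1
  have h3 := hi.2
  rw [le_antisymm h1 h2] at h3
  exact Set.disjoint_left.1 (pairwise_disjoint_facet a hij) h3 hj.2

/-- The facet cones exhaust the polyhedron up to its recession cone: a point is scaled by the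
largest value of the functionals `⟪a i, ·⟫`. -/
theorem polyhedron_subset_iUnion_facetCone (h0 : ∀ x, (∀ i, inner ℝ (a i) x ≤ 0) → x = 0) :
    polyhedron a ⊆ {0} ∪ ⋃ i, facetCone a i := by
  classical
  intro y hy
  by_cases hyz : y = 0
  · exact Or.inl hyz
  right
  have hpos : ∃ i, 0 < inner ℝ (a i) y := by
    by_contra! h
    exact hyz (h0 y h)
  obtain ⟨i₀, hi₀⟩ := hpos
  obtain ⟨k, -, hk⟩ := Finset.exists_max_image Finset.univ (fun i => inner ℝ (a i) y)
    ⟨i₀, Finset.mem_univ _⟩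
  have hkpos : 0 < inner ℝ (a k) y := hi₀.trans_le (hk i₀ (Finset.mem_univ _))
  have hfr : (inner ℝ (a k) y)⁻¹ • y ∈ frontier (polyhedron a) := by
    refine mem_frontier_polyhedron a (i := k) (fun j => ?_) ?_
    · rw [inner_smul_right, inv_mul_le_iff₀ hkpos, mul_one]
      exact hk j (Finset.mem_univ _)
    · rw [inner_smul_right, inv_mul_cancel₀ hkpos.ne']
  rw [← iUnion_facet, Set.mem_iUnion] at hfr
  obtain ⟨i, hi⟩ := hfr
  have hik : inner ℝ (a i) y = inner ℝ (a k) y := by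
    have := hi.2.1
    rwa [inner_smul_right, inv_mul_eq_one₀ hkpos.ne', eq_comm] at this
  refine Set.mem_iUnion.2 ⟨i, ⟨hik ▸ hkpos, hy i⟩, ?_⟩
  rw [hik]
  exact hi

end Polyhedron

section Area

variable {n m : ℕ} (a : Fin m → EuclideanSpace ℝ (Fin n))

theorem surfaceArea_polyhedron (hn : 1 ≤ n) :
    surfaceArea (polyhedron a) = ∑ i, n * ‖a i‖ₑ * volume (facetCone a i) := by
  rw [surfaceArea, ← iUnion_facet, measure_iUnion (pairwise_disjoint_facet a)
    (measurableSet_facet a), tsum_fintype]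
  refine Finset.sum_congr rfl fun i _ => ?_
  by_cases hi : a i = 0
  · have : facet a i = ∅ := Set.eq_empty_of_forall_notMem fun x hx => by
      simpa [hi] using hx.2.1
    simp [this, hi]
  · exact (volume_cone hn hi (measurableSet_facet a i) fun x hx => hx.2.1).symm

/-- A polyhedron that contains the unit ball has surface area at most `n` times its volume. -/
theorem surfaceArea_polyhedron_le (hn : 1 ≤ n) (ha : ∀ i, ‖a i‖ ≤ 1) :
    surfaceArea (polyhedron a) ≤ n * volume (polyhedron a) := by
  rw [surfaceArea_polyhedron a hn]
  calc ∑ i, n * ‖a i‖ₑ * volume (facetCone a i) ≤ ∑ i, n * volume (facetCone a i) := by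
        gcongr with i
        have : ‖a i‖ₑ ≤ 1 := by
          rw [← ofReal_norm, ← ENNReal.ofReal_one]; exact ENNReal.ofReal_le_ofReal (ha i)
        calc (n : ENNReal) * ‖a i‖ₑ ≤ n * 1 := by gcongr
          _ = n := mul_one _
    _ = n * volume (⋃ i, facetCone a i) := by
        rw [measure_iUnion (pairwise_disjoint_facetCone a) (measurableSet_facetCone a),
          tsum_fintype, Finset.mul_sum]
    _ ≤ n * volume (polyhedron a) := by
        gcongr
        exact Set.iUnion_subset (facetCone_subset a)

/-- A polyhedron all of whose facets are at distance `1` from `0`, and which contains no half-line,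
has surface area at least `n` times its volume. -/
theorem le_surfaceArea_polyhedron (hn : 1 ≤ n) (ha : ∀ i, ‖a i‖ = 1)
    (h0 : ∀ x, (∀ i, inner ℝ (a i) x ≤ 0) → x = 0) :
    n * volume (polyhedron a) ≤ surfaceArea (polyhedron a) := by
  have : Nonempty (Fin n) := ⟨⟨0, hn⟩⟩
  rw [surfaceArea_polyhedron a hn]
  calc n * volume (polyhedron a) ≤ n * (volume ({0} ∪ ⋃ i, facetCone a i)) := by
        gcongr
        exact polyhedron_subset_iUnion_facetCone a h0
    _ ≤ n * (volume {(0 : EuclideanSpace ℝ (Fin n))} + ∑ i, volume (facetCone a i)) := by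
        gcongr
        refine (measure_union_le _ _).trans ?_
        gcongr
        exact measure_iUnion_fintype_le _ _
    _ = ∑ i, n * ‖a i‖ₑ * volume (facetCone a i) := by
        rw [measure_singleton, zero_add, Finset.mul_sum]
        refine Finset.sum_congr rfl fun i _ => ?_
        rw [← ofReal_norm, ha i]; simp

end Area

section Convex

open scoped Pointwise

variable {E : Type*} [NormedAddCommGroup E] [InnerProductSpace ℝ E] [FiniteDimensional ℝ E]

/-- A convex body containing the unit ball is approximated from outside by polyhedra: by compactness
finitely many half-spaces containing `C` keep away from the boundary of a dilate of `C`. -/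
theorem exists_polyhedron_between {C : Set E} (hC : Convex ℝ C) (hCc : IsCompact C)
    (hB : Metric.closedBall 0 1 ⊆ C) {r : ℝ} (hr : 1 < r) :
    ∃ (m : ℕ) (a : Fin m → E), (∀ i, ‖a i‖ ≤ 1) ∧ C ⊆ polyhedron a ∧ polyhedron a ⊆ r • C := by
  have hr0 : 0 < r := by linarith
  have h0 : (0 : E) ∈ interior C := by
    rw [mem_interior]
    exact ⟨Metric.ball 0 1, Metric.ball_subset_closedBall.trans hB, Metric.isOpen_ball, by simp⟩
  have hsep : ∀ y ∈ frontier (r • C), ∃ a : E, (∀ x ∈ C, inner ℝ a x ≤ 1) ∧ 1 < inner ℝ a y := by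
    intro y hy
    have hyC : y ∉ C := by
      intro hyC
      refine hy.2 ?_
      rw [interior_smul₀ hr0.ne', Set.mem_smul_set_iff_inv_smul_mem₀ hr0.ne']
      have := hC.combo_interior_self_mem_interior h0 hyC (a := 1 - r⁻¹) (b := r⁻¹)
        (by simpa using inv_lt_one_of_one_lt₀ hr) (by positivity) (by ring)
      simpa using this
    obtain ⟨f, u, hf, hu⟩ := geometric_hahn_banach_closed_point hC hCc.isClosed hyC
    have hu0 : 0 < u := by simpa using hf 0 (interior_subset h0)
    refine ⟨u⁻¹ • (InnerProductSpace.toDual ℝ E).symm f, fun x hx => ?_, ?_⟩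
    · simp only [real_inner_smul_left, InnerProductSpace.toDual_symm_apply]
      rw [inv_mul_le_iff₀ hu0, mul_one]; exact (hf x hx).le
    · simp only [real_inner_smul_left, InnerProductSpace.toDual_symm_apply]
      rw [lt_inv_mul_iff₀ hu0, mul_one]; exact hu
  have hfc : IsCompact (frontier (r • C)) :=
    (hCc.smul r).of_isClosed_subset isClosed_frontier (hCc.smul r).isClosed.frontier_subset
  obtain ⟨t, ht⟩ := hfc.elim_finite_subcover
    (fun a : {a : E // ∀ x ∈ C, inner ℝ a x ≤ 1} => {y : E | 1 < inner ℝ (a : E) y})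
    (fun a => isOpen_lt continuous_const (by fun_prop)) (fun y hy => by
      obtain ⟨a, ha, hay⟩ := hsep y hy
      exact Set.mem_iUnion.2 ⟨⟨a, ha⟩, hay⟩)
  let e := t.equivFin.symm
  refine ⟨t.card, fun i => ((e i).1 : E), fun i => ?_, fun x hx i => (e i).1.2 x hx, ?_⟩
  · have hmem := (e i).1.2
    change ‖((e i).1 : E)‖ ≤ 1
    set b : E := ((e i).1 : E)
    by_cases hb : b = 0
    · simp [hb]
    · have hn := norm_pos_iff.2 hb
      have := hmem (‖b‖⁻¹ • b) (hB (by simp [norm_smul, hn.ne']))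
      rwa [inner_smul_right, real_inner_self_eq_norm_sq, inv_mul_le_iff₀ hn, mul_one, sq,
        mul_le_iff_le_one_right hn] at this
  · have hdisj : polyhedron (fun i => ((e i).1 : E)) ∩ frontier (r • C) = ∅ := by
      refine Set.eq_empty_of_forall_notMem fun y hy => ?_
      obtain ⟨a, ha, hay⟩ := Set.mem_iUnion₂.1 (ht hy.2)
      have := hy.1 (t.equivFin ⟨a, ha⟩)
      simp only [e, Equiv.symm_apply_apply] at this
      exact absurd this (not_le.2 hay)
    by_contra hsub
    obtain ⟨x, hx, hxC⟩ := Set.not_subset.1 hsub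
    have hpre := (convex_polyhedron (fun i => ((e i).1 : E))).isPreconnected
    have hcover : polyhedron (fun i => ((e i).1 : E)) ⊆ interior (r • C) ∪ (r • C)ᶜ := by
      intro y hy
      by_contra hn
      rw [Set.mem_union, not_or, Set.notMem_compl_iff] at hn
      exact Set.eq_empty_iff_forall_notMem.1 hdisj y ⟨hy, subset_closure hn.2, hn.1⟩
    have h0r : (0 : E) ∈ interior (r • C) := by
      rw [interior_smul₀ hr0.ne']
      exact ⟨0, h0, by simp⟩
    obtain ⟨y, -, hy1, hy2⟩ := hpre (interior (r • C)) (r • C)ᶜ isOpen_interior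
      (hCc.smul r).isClosed.isOpen_compl hcover ⟨0, fun i => by simp, h0r⟩ ⟨x, hx, hxC⟩
    exact hy2 (interior_subset hy1)

end Convex

open scoped Pointwise in
/-- A convex body that contains the unit ball has surface area at most `n` times its volume. -/
theorem surfaceArea_le_of_closedBall_subset {n : ℕ} (hn : 1 ≤ n)
    {C : Set (EuclideanSpace ℝ (Fin n))} (hC : Convex ℝ C) (hCc : IsCompact C)
    (hB : Metric.closedBall 0 1 ⊆ C) : surfaceArea C ≤ n * volume C := by
  have hCi : (interior C).Nonempty := ⟨0, by
    rw [mem_interior]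
    exact ⟨Metric.ball 0 1, Metric.ball_subset_closedBall.trans hB, Metric.isOpen_ball, by simp⟩⟩
  have key : ∀ r : ℝ, 1 < r → surfaceArea C ≤ n * (ENNReal.ofReal (r ^ n) * volume C) := by
    intro r hr
    obtain ⟨m, a, ha, hCa, har⟩ := exists_polyhedron_between hC hCc hB hr
    have hP : IsCompact (polyhedron a) :=
      (hCc.smul r).of_isClosed_subset (isClosed_polyhedron a) har
    calc surfaceArea C ≤ surfaceArea (polyhedron a) :=
          euclideanHausdorffMeasure_frontier_mono hC hCc.isClosed hCi hP hCa _
      _ ≤ n * volume (polyhedron a) := surfaceArea_polyhedron_le a hn ha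
      _ ≤ n * volume (r • C) := by gcongr
      _ = n * (ENNReal.ofReal (r ^ n) * volume C) := by
          rw [Measure.addHaar_smul, finrank_euclideanSpace_fin, abs_of_pos (by positivity)]
  have hlim : Filter.Tendsto (fun r : ℝ => n * (ENNReal.ofReal (r ^ n) * volume C))
      (nhdsWithin 1 (Set.Ioi 1)) (nhds (n * (ENNReal.ofReal (1 ^ n) * volume C))) := by
    refine ENNReal.Tendsto.const_mul (ENNReal.Tendsto.mul_const ?_ (Or.inr hCc.measure_ne_top))
      (Or.inr (ENNReal.natCast_ne_top n))
    exact ENNReal.tendsto_ofReal (((continuous_pow n).tendsto 1).mono_left nhdsWithin_le_nhds)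
  have := ge_of_tendsto hlim (Filter.eventually_of_mem self_mem_nhdsWithin key)
  simpa using this

/-! ### John's theorem -/

section ConvexHull

variable {W : Type*} [NormedAddCommGroup W] [NormedSpace ℝ W] [FiniteDimensional ℝ W]

/-- In finite dimension the convex hull of a compact set is compact: by Carathéodory's theorem it is
a finite union of continuous images of products of `s` with standard simplices. -/
theorem IsCompact.convexHull_of_finiteDimensional {s : Set W} (hs : IsCompact s) :
    IsCompact (convexHull ℝ s) := by
  let G : (k : ℕ) → (Fin k → ℝ) × (Fin k → W) → W := fun k q => ∑ i, q.1 i • q.2 i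
  have hG : ∀ k, Continuous (G k) := fun k => by fun_prop
  have heq : convexHull ℝ s = ⋃ k ∈ Set.Iic (Module.finrank ℝ W + 1),
      G k '' (stdSimplex ℝ (Fin k) ×ˢ Set.univ.pi fun _ => s) := by
    apply Set.Subset.antisymm
    · intro x hx
      obtain ⟨ι, _, z, w, hz, hai, hw, hw1, hx⟩ := eq_pos_convex_span_of_mem_convexHull hx
      have hcard : Fintype.card ι ≤ Module.finrank ℝ W + 1 :=
        hai.card_le_finrank_succ.trans (Nat.succ_le_succ (Submodule.finrank_le _))
      let e := (Fintype.equivFin ι).symm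
      refine Set.mem_biUnion hcard ⟨(w ∘ e, z ∘ e), ⟨⟨fun i => (hw _).le, ?_⟩, fun i _ => hz ⟨_, rfl⟩⟩, ?_⟩
      · rw [← hw1]; exact e.sum_comp w
      · rw [← hx]; exact e.sum_comp fun i => w i • z i
    · refine Set.iUnion₂_subset fun k _ => ?_
      rintro _ ⟨⟨w, z⟩, ⟨hw, hz⟩, rfl⟩
      exact mem_convexHull_of_exists_fintype w z hw.1 hw.2 (fun i => hz i trivial) rfl
  rw [heq]
  exact (Set.finite_Iic _).isCompact_biUnion fun k _ =>
    ((isCompact_stdSimplex _ _).prod (isCompact_univ_pi fun _ => hs)).image (hG k)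

end ConvexHull

section John

/-- Every convex body is an affine image of one for which the unit ball has maximal volume among the
inscribed ellipsoids. -/
theorem exists_affineEquiv_closedBall_maximal {E : Type*} [NormedAddCommGroup E]
    [InnerProductSpace ℝ E] [FiniteDimensional ℝ E] {C : Set E} (hCc : IsCompact C)
    (hCi : (interior C).Nonempty) :
    ∃ ψ : E ≃ᵃ[ℝ] E, Metric.closedBall 0 1 ⊆ ψ '' C ∧ ∀ (L : E →L[ℝ] E) (b : E),
      (∀ x ∈ Metric.closedBall (0 : E) 1, L x + b ∈ ψ '' C) → |L.det| ≤ 1 := by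
  -- Maximise `|det A|` over the compact set of pairs `(A, b)` for which `x ↦ A x + b` maps the unit
  -- ball into `C`; the inverse of the maximising map has the required property.
  let S : Set ((E →L[ℝ] E) × E) := {q | ∀ x ∈ Metric.closedBall (0 : E) 1, q.1 x + q.2 ∈ C}
  have hSc : IsClosed S := by
    have : S = ⋂ x ∈ Metric.closedBall (0 : E) 1, {q : (E →L[ℝ] E) × E | q.1 x + q.2 ∈ C} := by
      ext q; simp [S]
    rw [this]
    exact isClosed_biInter fun x _ => hCc.isClosed.preimage (by fun_prop)
  obtain ⟨R, hR⟩ := hCc.isBounded.exists_norm_le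
  have hSb : Bornology.IsBounded S := by
    refine (Metric.isBounded_closedBall (x := 0) (r := 2 * R)).subset fun q hq => ?_
    have h2 : ‖q.2‖ ≤ R := by simpa using hR _ (hq 0 (by simp))
    have hR0 : 0 ≤ R := (norm_nonneg _).trans h2
    have h1 : ‖q.1‖ ≤ 2 * R := by
      refine ContinuousLinearMap.opNorm_le_of_unit_norm (by positivity) fun x hx => ?_
      have := hR _ (hq x (by simp [hx]))
      calc ‖q.1 x‖ = ‖(q.1 x + q.2) - q.2‖ := by simp
        _ ≤ ‖q.1 x + q.2‖ + ‖q.2‖ := norm_sub_le _ _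
        _ ≤ 2 * R := by linarith
    rw [mem_closedBall_zero_iff]
    exact max_le h1 (h2.trans (by linarith))
  obtain ⟨p, hp⟩ := hCi
  obtain ⟨ε, hε, hball⟩ := Metric.isOpen_iff.1 isOpen_interior p hp
  have hmem : ((ε / 2) • ContinuousLinearMap.id ℝ E, p) ∈ S := by
    intro x hx
    rw [mem_closedBall_zero_iff] at hx
    refine interior_subset (hball ?_)
    rw [Metric.mem_ball, dist_eq_norm]
    simp only [smul_apply, ContinuousLinearMap.id_apply, add_sub_cancel_right,
      norm_smul, Real.norm_eq_abs, abs_of_pos (half_pos hε)]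
    nlinarith
  obtain ⟨⟨A, b₀⟩, hA, hmax⟩ := (Metric.isCompact_of_isClosed_isBounded hSc hSb).exists_isMaxOn
    ⟨_, hmem⟩ (f := fun q => |q.1.det|)
    ((ContinuousLinearMap.continuous_det.comp continuous_fst).abs.continuousOn)
  have hdet : 0 < |A.det| := by
    refine lt_of_lt_of_le ?_ (hmax hmem)
    have : ((ε / 2) • ContinuousLinearMap.id ℝ E).det = (ε / 2) ^ Module.finrank ℝ E := by
      rw [ContinuousLinearMap.det]
      simp
    simp only [this]
    positivity
  have hdet0 : LinearMap.det (A : E →ₗ[ℝ] E) ≠ 0 := abs_pos.1 hdet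
  let e : E ≃ₗ[ℝ] E := LinearEquiv.ofIsUnitDet (v := Module.finBasis ℝ E) (v' := Module.finBasis ℝ E)
    (f := (A : E →ₗ[ℝ] E)) (by simpa using hdet0)
  have he : ∀ x, e x = A x := fun x => rfl
  let φ : E ≃ᵃ[ℝ] E := e.toAffineEquiv.trans (AffineEquiv.constVAdd ℝ E b₀)
  have hφ : ∀ x, φ x = A x + b₀ := fun x => by simp [φ, he, add_comm]
  have hψ : ∀ y, y ∈ φ.symm '' C ↔ A y + b₀ ∈ C := by
    intro y
    rw [← hφ]
    constructor
    · rintro ⟨c, hc, rfl⟩; simpa using hc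
    · intro h; exact ⟨φ y, h, by simp⟩
  refine ⟨φ.symm, fun x hx => (hψ x).2 (hA x hx), fun L b hL => ?_⟩
  have hmem' : (A.comp L, A b + b₀) ∈ S := by
    intro x hx
    have := (hψ _).1 (hL x hx)
    simpa [add_assoc] using this
  have := hmax hmem'
  simp only [ContinuousLinearMap.det] at this
  exact le_of_mul_le_mul_left (by simpa using this) hdet

variable {n : ℕ}

local notation "E" => EuclideanSpace ℝ (Fin n)

/-- If `⟪u, H u⟫ + ⟪v, u⟫ < 0` at all contact points `u` of the unit ball with `C`, then the
perturbed ball `(1 + t H) B + t v` stays inside `C` for some arbitrarily small `t > 0`. -/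
theorem exists_perturbation_subset {C : Set E} (hC : Convex ℝ C) (hCc : IsClosed C)
    (hB : Metric.closedBall 0 1 ⊆ C) (H : E →L[ℝ] E) (v : E)
    (hneg : ∀ u : E, ‖u‖ = 1 → (∀ x ∈ C, inner ℝ u x ≤ 1) → inner ℝ u (H u + v) < 0)
    {p : ℝ → Prop} (hp : ∀ᶠ t in nhdsWithin (0 : ℝ) (Set.Ioi 0), p t) :
    ∃ t, p t ∧ ∀ x ∈ Metric.closedBall (0 : E) 1, x + t • (H x + v) ∈ C := by
  by_contra! hcon
  have hsep : ∀ᶠ t in nhdsWithin (0 : ℝ) (Set.Ioi 0), 0 < t ∧ ∃ q : E × E,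
      q ∈ Metric.closedBall (0 : E) 1 ×ˢ Metric.sphere (0 : E) 1 ∧
      ∀ c ∈ C, inner ℝ q.2 c ≤ inner ℝ q.2 (q.1 + t • (H q.1 + v)) := by
    filter_upwards [hp, self_mem_nhdsWithin] with t ht ht0
    refine ⟨ht0, ?_⟩
    obtain ⟨x, hx, hxC⟩ := hcon t ht
    obtain ⟨f, s, hf, hs⟩ := geometric_hahn_banach_closed_point hC hCc hxC
    set w := (InnerProductSpace.toDual ℝ E).symm f with hw
    have hfw : ∀ x, f x = inner ℝ w x := fun x => by simp [hw]
    have hw0 : w ≠ 0 := by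
      intro h0
      have := (hf 0 (hB (by simp))).trans hs
      simp [hfw, h0] at this
    refine ⟨(x, ‖w‖⁻¹ • w), ⟨hx, by simp [norm_smul, hw0]⟩, fun c hc => ?_⟩
    simp only [real_inner_smul_left]
    have := ((hf c hc).trans hs).le
    rw [hfw, hfw] at this
    gcongr
  obtain ⟨t, htlim, ht⟩ := Filter.exists_seq_forall_of_frequently hsep.frequently
  choose ht0 q hq hqC using ht
  obtain ⟨⟨x, w⟩, hxw, g, hg, hlim⟩ :=
    ((isCompact_closedBall (0 : E) 1).prod (isCompact_sphere (0 : E) 1)).tendsto_subseq hq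
  have htg : Filter.Tendsto (t ∘ g) Filter.atTop (nhds 0) :=
    (htlim.mono_right nhdsWithin_le_nhds).comp hg.tendsto_atTop
  have hx1 : Filter.Tendsto (fun k => (q (g k)).1) Filter.atTop (nhds x) := hlim.fst_nhds
  have hw1 : Filter.Tendsto (fun k => (q (g k)).2) Filter.atTop (nhds w) := hlim.snd_nhds
  have hHx : Filter.Tendsto (fun k => H (q (g k)).1 + v) Filter.atTop (nhds (H x + v)) :=
    ((H.continuous.tendsto x).comp hx1).add_const v
  have hsupp : ∀ c ∈ C, inner ℝ w c ≤ inner ℝ w x := by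
    intro c hc
    refine le_of_tendsto_of_tendsto' (hw1.inner tendsto_const_nhds)
      (?_ : Filter.Tendsto _ _ _) fun k => hqC (g k) c hc
    have := hw1.inner (hx1.add (htg.smul hHx)) (𝕜 := ℝ)
    simpa using this
  have hxn : ‖x‖ ≤ 1 := by simpa using hxw.1
  have hwn : ‖w‖ = 1 := by simpa using hxw.2
  have hwx : 1 ≤ inner ℝ w x := by
    have := hsupp w (hB (by simp [hwn]))
    rwa [real_inner_self_eq_norm_sq, hwn, one_pow] at this
  have hle1 : inner ℝ w x ≤ 1 := by
    have := real_inner_le_norm w x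
    rw [hwn, one_mul] at this
    exact this.trans hxn
  -- In the limit the supporting half-space touches the unit ball, so `x = w` is a contact point.
  have hxw' : x = w := by
    have h := norm_sub_sq_real x w
    rw [real_inner_comm, hwn] at h
    have : ‖x - w‖ ^ 2 ≤ 0 := by nlinarith [norm_nonneg x]
    exact sub_eq_zero.1 (norm_eq_zero.1 (pow_eq_zero_iff (two_ne_zero) |>.1
      (le_antisymm this (by positivity))))
  subst hxw'
  have hge : 0 ≤ inner ℝ x (H x + v) := by
    refine ge_of_tendsto' (hw1.inner hHx) fun k => ?_
    have h1 := hqC (g k) (q (g k)).2 (hB (Metric.sphere_subset_closedBall (hq (g k)).2))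
    have hn1 : ‖(q (g k)).1‖ ≤ 1 := by simpa using (hq (g k)).1
    have hn2 : ‖(q (g k)).2‖ = 1 := by simpa using (hq (g k)).2
    have h2 := real_inner_le_norm (q (g k)).2 (q (g k)).1
    rw [real_inner_self_eq_norm_sq, inner_add_right, inner_smul_right, hn2] at h1
    rw [hn2, one_mul] at h2
    have h3 : 0 ≤ t (g k) * inner ℝ (q (g k)).2 (H (q (g k)).1 + v) := by linarith
    exact nonneg_of_mul_nonneg_right h3 (ht0 (g k))
  exact absurd (hneg x hwn fun c hc => (hsupp c hc).trans hle1) (not_lt.2 hge)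

/-- **John's theorem**: if the unit ball has maximal volume among the ellipsoids in `C`, then its
contact points with `C` carry a balanced decomposition of the identity. Contact points are encoded
as the unit vectors `u` for which `C` lies in the half-space `⟪u, x⟫ ≤ 1`. -/
theorem exists_john_decomposition (hn : 1 ≤ n) {C : Set E} (hC : Convex ℝ C) (hCc : IsClosed C)
    (hB : Metric.closedBall 0 1 ⊆ C)
    (hmax : ∀ (L : E →L[ℝ] E) (b : E),
      (∀ x ∈ Metric.closedBall (0 : E) 1, L x + b ∈ C) → |L.det| ≤ 1) :
    ∃ (ι : Type) (_ : Fintype ι) (c : ι → ℝ) (u : ι → E), (∀ i, 0 ≤ c i) ∧ (∀ i, ‖u i‖ = 1) ∧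
      (∀ i, ∀ x ∈ C, inner ℝ (u i) x ≤ 1) ∧ ∑ i, c i = n ∧ ∑ i, c i • u i = 0 ∧
      ∀ x, ∑ i, c i • inner ℝ (u i) x • u i = x := by
  have hn0 : (0 : ℝ) < n := by exact_mod_cast hn
  let U : Set E := {u | ‖u‖ = 1 ∧ ∀ x ∈ C, inner ℝ u x ≤ 1}
  have hU : IsCompact U := by
    refine (isCompact_sphere (0 : E) 1).of_isClosed_subset ?_ fun u hu => by simpa using hu.1
    have : U = {u | ‖u‖ = 1} ∩ ⋂ x ∈ C, {u | inner ℝ u x ≤ 1} := by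
      ext u; simp [U]
    rw [this]
    exact (isClosed_eq continuous_norm continuous_const).inter
      (isClosed_biInter fun x _ => isClosed_le (by fun_prop) continuous_const)
  let g : E → (Fin n × Fin n → ℝ) × E := fun u => (fun p => u p.1 * u p.2, u)
  have hg : Continuous g := by fun_prop
  let τ : (Fin n × Fin n → ℝ) × E := (fun p => if p.1 = p.2 then (n : ℝ)⁻¹ else 0, 0)
  -- The decomposition says that `(n⁻¹ I, 0)` is a convex combination of the points `(u ⊗ u, u)`.
  by_cases hτ : τ ∈ convexHull ℝ (g '' U)
  · obtain ⟨ι, _, w, z, hw0, hw1, hz, hx⟩ := mem_convexHull_iff_exists_fintype.1 hτ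
    choose u hu huz using hz
    have h1 : ∀ p : Fin n × Fin n, ∑ i, w i * (u i p.1 * u i p.2) =
        if p.1 = p.2 then (n : ℝ)⁻¹ else 0 := by
      intro p
      have := congrFun (congrArg Prod.fst hx) p
      simpa [Prod.fst_sum, Finset.sum_apply, ← huz, g, τ] using this
    have h2 : ∑ i, w i • u i = 0 := by
      have := congrArg Prod.snd hx
      simpa [Prod.snd_sum, ← huz, g, τ] using this
    refine ⟨ι, inferInstance, fun i => n * w i, u, fun i => by have := hw0 i; positivity,
      fun i => (hu i).1, fun i => (hu i).2, ?_, ?_, fun x => ?_⟩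
    · rw [← Finset.mul_sum, hw1, mul_one]
    · simp_rw [mul_smul]
      rw [← Finset.smul_sum, h2, smul_zero]
    · ext k
      have : (∑ i, (n * w i) • inner ℝ (u i) x • u i) k =
          ∑ j, n * x j * ∑ i, w i * (u i j * u i k) := by
        simp only [WithLp.ofLp_sum, WithLp.ofLp_smul, Finset.sum_apply, Pi.smul_apply, smul_eq_mul,
          PiLp.inner_apply, Finset.sum_mul, Finset.mul_sum]
        rw [Finset.sum_comm]
        refine Finset.sum_congr rfl fun j _ => Finset.sum_congr rfl fun i _ => ?_
        simp only [RCLike.inner_apply, conj_trivial]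
        ring
      rw [this]
      simp only [fun j => h1 (j, k)]
      simp [hn0.ne', mul_comm]
  · exfalso
    obtain ⟨f, s, hf, hs⟩ := geometric_hahn_banach_closed_point (convex_convexHull ℝ (g '' U))
      (hU.image hg).convexHull_of_finiteDimensional.isClosed hτ
    -- A separating functional gives `H` and `v` as in `exists_perturbation_subset`. Subtracting `s`
    -- from the diagonal makes both inequalities homogeneous: `0 < tr H` and `⟪u, H u + v⟫ < 0`.
    let M : Matrix (Fin n) (Fin n) ℝ := Matrix.of fun i j => f (Pi.single (i, j) 1, 0)
    let H : Matrix (Fin n) (Fin n) ℝ := M - s • (1 : Matrix (Fin n) (Fin n) ℝ)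
    let v : E := (InnerProductSpace.toDual ℝ E).symm (f.comp (ContinuousLinearMap.inr ℝ _ E))
    have hfM : ∀ (m : Fin n × Fin n → ℝ) (x : E),
        f (m, x) = ∑ p : Fin n × Fin n, m p * M p.1 p.2 + inner ℝ v x := by
      intro m x
      have h1 : (m, x) = (m, (0 : E)) + (0, x) := by simp
      have h2 : f (m, 0) = ∑ p, m p * M p.1 p.2 := by
        have := LinearMap.pi_apply_eq_sum_univ
          ((f.comp (ContinuousLinearMap.inl ℝ (Fin n × Fin n → ℝ) E)).toLinearMap) m
        simp only [ContinuousLinearMap.coe_coe, ContinuousLinearMap.comp_apply,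
          ContinuousLinearMap.inl_apply, smul_eq_mul] at this
        rw [this]
        refine Finset.sum_congr rfl fun p _ => ?_
        simp only [M, Matrix.of_apply]
        congr 3
        ext q
        simp [Pi.single_apply, eq_comm]
      rw [h1, map_add, h2]
      simp [v]
    have htr : 0 < H.trace := by
      have : f τ = (n : ℝ)⁻¹ * M.trace := by
        rw [hfM]
        simp [Fintype.sum_prod_type, Matrix.trace, Finset.mul_sum]
      rw [this, lt_inv_mul_iff₀ hn0] at hs
      simp only [H, Matrix.trace_sub, Matrix.trace_smul, Matrix.trace_one, Fintype.card_fin,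
        smul_eq_mul]
      linarith
    let L : E →L[ℝ] E := Matrix.toEuclideanCLM (n := Fin n) (𝕜 := ℝ) H
    have hneg : ∀ u : E, ‖u‖ = 1 → (∀ x ∈ C, inner ℝ u x ≤ 1) → inner ℝ u (L u + v) < 0 := by
      intro u hu huC
      have h1 := hf (g u) (subset_convexHull ℝ _ ⟨u, ⟨hu, huC⟩, rfl⟩)
      have h2 : inner ℝ u (L u) = ∑ p : Fin n × Fin n, u p.1 * u p.2 * M p.1 p.2 - s := by
        have hLu : L u = Matrix.toEuclideanCLM (n := Fin n) (𝕜 := ℝ) M u - s • u := by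
          simp [L, H]
        rw [hLu, inner_sub_right, inner_smul_right, real_inner_self_eq_norm_sq, hu, one_pow, mul_one]
        congr 1
        rw [Fintype.sum_prod_type]
        simp only [PiLp.inner_apply, Matrix.ofLp_toEuclideanCLM, Matrix.mulVec, dotProduct,
          RCLike.inner_apply, conj_trivial, Finset.sum_mul]
        refine Finset.sum_congr rfl fun i _ => Finset.sum_congr rfl fun j _ => by ring
      rw [hfM] at h1
      rw [inner_add_right, h2, real_inner_comm]
      linarith
    have hdet : ∀ᶠ t in nhdsWithin (0 : ℝ) (Set.Ioi 0), 1 < (1 + t • H).det := by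
      set P := (Matrix.det (1 + (Polynomial.X : Polynomial ℝ) • H.map Polynomial.C)).divX.divX
      have hlim : Filter.Tendsto (fun t => H.trace + P.eval t * t) (nhds 0) (nhds H.trace) := by
        have : Continuous fun t => H.trace + P.eval t * t := by fun_prop
        simpa using this.tendsto 0
      filter_upwards [nhdsWithin_le_nhds (hlim.eventually (lt_mem_nhds htr)), self_mem_nhdsWithin]
        with t ht ht0
      rw [Matrix.det_one_add_smul]
      have := mul_pos ht (show 0 < t from ht0)
      nlinarith
    obtain ⟨t, ht, htC⟩ := exists_perturbation_subset hC hCc hB L v hneg hdet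
    have hle := hmax (Matrix.toEuclideanCLM (n := Fin n) (𝕜 := ℝ) (1 + t • H)) (t • v) fun x hx => by
      have := htC x hx
      simpa [L, smul_add, add_assoc] using this
    have hd : (Matrix.toEuclideanCLM (n := Fin n) (𝕜 := ℝ) (1 + t • H)).det = (1 + t • H).det := by
      rw [ContinuousLinearMap.det, Matrix.coe_toEuclideanCLM_eq_toEuclideanLin]
      exact LinearMap.det_toLpLin _ _
    rw [hd] at hle
    exact absurd (ht.trans_le (le_abs_self _)) (not_lt.2 hle)

end John

/-! ### The Brascamp–Lieb inequality for exponential densities -/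

section Transport

/-- The monotone map transporting the exponential law on `(0, ∞)` to the Gaussian density
`exp (-π s ^ 2)`, together with its derivative. -/
theorem exists_transport_exp_gaussian :
    ∃ T T' : ℝ → ℝ, (∀ t, 0 < t → HasDerivAt T (T' t) t) ∧ (∀ t, 0 < t → 0 < T' t) ∧
      (∀ t, 0 < t → Real.exp (-t) = Real.exp (-(Real.pi * T t ^ 2)) * T' t) := by
  -- `G` is the Gaussian distribution function shifted to have range `(-1/2, 1/2)`, and
  -- `T t = G⁻¹ (1/2 - exp (-t))`.
  set φ : ℝ → ℝ := fun x => Real.exp (-Real.pi * x ^ 2) with hφ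
  have hφc : Continuous φ := by fun_prop
  set G : ℝ → ℝ := fun s => ∫ x in (0 : ℝ)..s, φ x with hG
  have hGd : ∀ s, HasDerivAt G (φ s) s := fun s => hφc.integral_hasStrictDerivAt 0 s |>.hasDerivAt
  have hGc : Continuous G := continuous_iff_continuousAt.2 fun s => (hGd s).continuousAt
  have hGm : StrictMono G := strictMono_of_deriv_pos fun s => by
    rw [(hGd s).deriv]; exact Real.exp_pos _
  have hlim : Filter.Tendsto G Filter.atTop (nhds (1 / 2)) := by
    have h1 := intervalIntegral_tendsto_integral_Ioi (f := φ) (μ := volume) 0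
      (integrable_exp_neg_mul_sq Real.pi_pos).integrableOn Filter.tendsto_id
    have h2 : ∫ x in Set.Ioi (0 : ℝ), φ x = 1 / 2 := by
      rw [hφ, integral_gaussian_Ioi, div_self Real.pi_ne_zero, Real.sqrt_one]
    rw [h2] at h1
    exact h1
  have hodd : ∀ s, G (-s) = - G s := by
    intro s
    have h := intervalIntegral.integral_comp_neg (a := 0) (b := s) φ
    have h2 : (∫ x in (0 : ℝ)..s, φ (-x)) = G s := by simp [hφ, hG]
    rw [h2, neg_zero, intervalIntegral.integral_symm] at h
    simp only [hG] at h ⊢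
    linarith
  have hrange : ∀ y ∈ Set.Ioo (-(1 / 2) : ℝ) (1 / 2), y ∈ Set.range G := by
    intro y hy
    obtain ⟨b, hb⟩ := (hlim.eventually (lt_mem_nhds hy.2)).exists
    obtain ⟨a, ha⟩ := (hlim.eventually (lt_mem_nhds (show -y < 1 / 2 by linarith [hy.1]))).exists
    refine mem_range_of_exists_le_of_exists_ge hGc ⟨-a, ?_⟩ ⟨b, hb.le⟩
    rw [hodd]; linarith
  set h := Function.invFun G with hh
  have hleft : ∀ s, h (G s) = s := Function.leftInverse_invFun hGm.injective
  have hright : ∀ y ∈ Set.Ioo (-(1 / 2) : ℝ) (1 / 2), G (h y) = y :=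
    fun y hy => Function.invFun_eq (hrange y hy)
  have hGmem : ∀ s, G s ∈ Set.Ioo (-(1 / 2) : ℝ) (1 / 2) := by
    have hlt : ∀ s, G s < 1 / 2 := fun s =>
      (hGm (lt_add_one s)).trans_le (hGm.monotone.ge_of_tendsto hlim _)
    intro s
    have := hlt (-s)
    rw [hodd] at this
    exact ⟨by linarith, hlt s⟩
  have hhd : ∀ y ∈ Set.Ioo (-(1 / 2) : ℝ) (1 / 2), HasDerivAt h (φ (h y))⁻¹ y := by
    intro y hy
    have hnhds : Set.Ioo (-(1 / 2) : ℝ) (1 / 2) ∈ nhds y := isOpen_Ioo.mem_nhds hy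
    refine HasDerivAt.of_local_left_inverse ?_ (hGd _) (Real.exp_pos _).ne'
      (Filter.eventually_of_mem hnhds hright)
    refine continuousAt_of_monotoneOn_of_image_mem_nhds (s := Set.Ioo (-(1 / 2) : ℝ) (1 / 2))
      (fun a ha b hb hab => ?_) hnhds (Filter.mem_of_superset Filter.univ_mem fun s _ =>
        ⟨G s, hGmem s, hleft s⟩)
    rw [← hGm.le_iff_le, hright a ha, hright b hb]
    exact hab
  have hmem : ∀ t : ℝ, 0 < t → 1 / 2 - Real.exp (-t) ∈ Set.Ioo (-(1 / 2) : ℝ) (1 / 2) := by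
    intro t ht
    have h1 : Real.exp (-t) < 1 := by simpa using ht
    have h2 := Real.exp_pos (-t)
    exact ⟨by linarith, by linarith⟩
  refine ⟨fun t => h (1 / 2 - Real.exp (-t)),
    fun t => (φ (h (1 / 2 - Real.exp (-t))))⁻¹ * Real.exp (-t), fun t ht => ?_, fun t _ => ?_,
    fun t _ => ?_⟩
  · have h1 : HasDerivAt (fun t : ℝ => 1 / 2 - Real.exp (-t)) (Real.exp (-t)) t := by
      have := ((hasDerivAt_neg t).exp).const_sub (1 / 2)
      simpa using this
    exact (hhd _ (hmem t ht)).comp t h1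
  · have := Real.exp_pos (-t)
    have := Real.exp_pos (-Real.pi * h (1 / 2 - Real.exp (-t)) ^ 2)
    positivity
  · simp only [hφ, neg_mul]
    rw [mul_inv_cancel_left₀ (Real.exp_pos _).ne']

end Transport

section BrascampLieb

variable {ι F : Type*} [Fintype ι] [NormedAddCommGroup F] [InnerProductSpace ℝ F]

theorem sum_mul_inner_sq_eq_norm_sq {d : ι → ℝ} {v : ι → F}
    (hI : ∀ y, ∑ i, d i • inner ℝ (v i) y • v i = y) (y : F) :
    ∑ i, d i * inner ℝ (v i) y ^ 2 = ‖y‖ ^ 2 := by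
  rw [← real_inner_self_eq_norm_sq]
  conv_rhs => rw [← hI y, sum_inner]
  refine Finset.sum_congr rfl fun i _ => ?_
  rw [hI y, real_inner_smul_left, real_inner_smul_left, sq]

/-- The operator `∑ dᵢ tᵢ vᵢ ⊗ vᵢ`. -/
noncomputable def weightedFrame (d t : ι → ℝ) (v : ι → F) : F →L[ℝ] F :=
  ∑ i, (d i • (t i • innerSL ℝ (v i))).smulRight (v i)

theorem weightedFrame_apply (d t : ι → ℝ) (v : ι → F) (y : F) :
    weightedFrame d t v y = ∑ i, (d i * (t i * inner ℝ (v i) y)) • v i := by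
  simp [weightedFrame]

/-- The determinant inequality behind the rank-one Brascamp–Lieb inequality. Each eigenvalue of the
operator is a weighted arithmetic mean of the `tᵢ`, hence at least the geometric mean with the same
weights. -/
theorem prod_rpow_le_det_weightedFrame [FiniteDimensional ℝ F] {d t : ι → ℝ} {v : ι → F}
    (hd : ∀ i, 0 ≤ d i) (ht : ∀ i, 0 < t i) (hv : ∀ i, ‖v i‖ = 1)
    (hI : ∀ y, ∑ i, d i • inner ℝ (v i) y • v i = y) :
    ∏ i, t i ^ d i ≤ (weightedFrame d t v).det := by
  have hsymm : (weightedFrame d t v : F →ₗ[ℝ] F).IsSymmetric := by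
    intro x y
    simp only [ContinuousLinearMap.coe_coe, weightedFrame_apply, sum_inner, inner_sum,
      real_inner_smul_left, real_inner_smul_right]
    refine Finset.sum_congr rfl fun i _ => ?_
    rw [real_inner_comm (v i) x]
    ring
  set e := hsymm.eigenvectorBasis rfl
  have heig : ∀ j, hsymm.eigenvalues rfl j = ∑ i, (d i * inner ℝ (v i) (e j) ^ 2) * t i := by
    intro j
    have h1 : (weightedFrame d t v : F →ₗ[ℝ] F) (e j) = (hsymm.eigenvalues rfl j : ℝ) • e j :=
      hsymm.apply_eigenvectorBasis rfl j
    have h2 : inner ℝ (e j) ((weightedFrame d t v : F →ₗ[ℝ] F) (e j)) = hsymm.eigenvalues rfl j := by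
      rw [h1, inner_smul_right, real_inner_self_eq_norm_sq, e.orthonormal.1 j]; simp
    rw [← h2, ContinuousLinearMap.coe_coe, weightedFrame_apply, inner_sum]
    refine Finset.sum_congr rfl fun i _ => ?_
    rw [inner_smul_right, real_inner_comm (v i) (e j)]
    ring
  have hdet : (weightedFrame d t v).det = ∏ j, hsymm.eigenvalues rfl j := by
    rw [ContinuousLinearMap.det, hsymm.det_eq_prod_eigenvalues rfl]
    simp
  rw [hdet]
  calc ∏ i, t i ^ d i = ∏ i, ∏ j, t i ^ (d i * inner ℝ (v i) (e j) ^ 2) := by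
        refine Finset.prod_congr rfl fun i _ => ?_
        rw [← Real.rpow_sum_of_pos (ht i), ← Finset.mul_sum]
        congr 1
        have : ∑ j, inner ℝ (v i) (e j) ^ 2 = 1 := by
          have := e.sum_sq_norm_inner_left (v i)
          simpa [hv i] using this
        rw [this, mul_one]
    _ = ∏ j, ∏ i, t i ^ (d i * inner ℝ (v i) (e j) ^ 2) := Finset.prod_comm
    _ ≤ ∏ j, hsymm.eigenvalues rfl j := by
        refine Finset.prod_le_prod (fun j _ => Finset.prod_nonneg fun i _ =>
          Real.rpow_nonneg (ht i).le _) fun j _ => ?_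
        rw [heig]
        refine Real.geom_mean_le_arith_mean_weighted _ _ _
          (fun i _ => mul_nonneg (hd i) (sq_nonneg _)) ?_ fun i _ => (ht i).le
        rw [sum_mul_inner_sq_eq_norm_sq hI, e.orthonormal.1 j, one_pow]

/-- The synthesis operator `s ↦ ∑ dᵢ sᵢ vᵢ` of a decomposition of the identity is a contraction from
the weighted `ℓ²` space; the deficit is `∑ dᵢ (sᵢ - ⟪vᵢ, z⟫) ^ 2`. -/
theorem norm_sum_smul_sq_le {d : ι → ℝ} {v : ι → F} (hd : ∀ i, 0 ≤ d i)
    (hI : ∀ y, ∑ i, d i • inner ℝ (v i) y • v i = y) (s : ι → ℝ) :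
    ‖∑ i, (d i * s i) • v i‖ ^ 2 ≤ ∑ i, d i * s i ^ 2 := by
  set z := ∑ i, (d i * s i) • v i with hz
  have h1 : ∑ i, d i * s i * inner ℝ (v i) z = ‖z‖ ^ 2 := by
    rw [← real_inner_self_eq_norm_sq]
    conv_rhs => rw [hz, sum_inner]
    exact Finset.sum_congr rfl fun i _ => (real_inner_smul_left _ _ _).symm
  have h2 := sum_mul_inner_sq_eq_norm_sq hI z
  have h3 : 0 ≤ ∑ i, d i * (s i - inner ℝ (v i) z) ^ 2 :=
    Finset.sum_nonneg fun i _ => mul_nonneg (hd i) (sq_nonneg _)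
  have h4 : ∑ i, d i * (s i - inner ℝ (v i) z) ^ 2 = ∑ i, d i * s i ^ 2
      - 2 * ∑ i, d i * s i * inner ℝ (v i) z + ∑ i, d i * inner ℝ (v i) z ^ 2 := by
    rw [Finset.mul_sum, ← Finset.sum_sub_distrib, ← Finset.sum_add_distrib]
    exact Finset.sum_congr rfl fun i _ => by ring
  linarith

variable [FiniteDimensional ℝ F] [MeasurableSpace F] [BorelSpace F]

/-- The geometric Brascamp–Lieb inequality for exponential densities, by transport to the Gaussian
measure. -/
theorem lintegral_exp_neg_sum_le_one {d : ι → ℝ} {v : ι → F} (hd : ∀ i, 0 ≤ d i)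
    (hv : ∀ i, ‖v i‖ = 1) (hI : ∀ y, ∑ i, d i • inner ℝ (v i) y • v i = y) :
    ∫⁻ y in {y | ∀ i, 0 < inner ℝ (v i) y},
      ENNReal.ofReal (Real.exp (-∑ i, d i * inner ℝ (v i) y)) ≤ 1 := by
  obtain ⟨T, T', hT, hT', hTe⟩ := exists_transport_exp_gaussian
  set D : Set F := {y | ∀ i, 0 < inner ℝ (v i) y} with hD
  have hDm : MeasurableSet D := by
    have : IsOpen D := by
      simp only [hD, Set.ofPred_forall]
      exact isOpen_iInter_of_finite fun i => isOpen_lt continuous_const (by fun_prop)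
    exact this.measurableSet
  have hmono : StrictMonoOn T (Set.Ioi 0) := by
    refine strictMonoOn_of_deriv_pos (convex_Ioi 0)
      (fun t ht => (hT t ht).continuousAt.continuousWithinAt) fun t ht => ?_
    rw [interior_Ioi] at ht
    rw [(hT t ht).deriv]
    exact hT' t ht
  let θ : F → F := fun y => ∑ i, (d i * T (inner ℝ (v i) y)) • v i
  let θ' : F → F →L[ℝ] F := fun y => weightedFrame d (fun i => T' (inner ℝ (v i) y)) v
  have hθ : ∀ y ∈ D, HasFDerivWithinAt θ (θ' y) D y := by
    intro y hy
    refine (HasFDerivAt.fun_sum fun i _ => ?_).hasFDerivWithinAt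
    exact (((hT _ (hy i)).comp_hasFDerivAt y (innerSL ℝ (v i)).hasFDerivAt).const_mul
      (d i)).smul_const (v i)
  -- `θ` is strictly monotone as a vector field, because `T` is increasing.
  have hinj : Set.InjOn θ D := by
    intro y hy z hz hyz
    have h1 : ∑ i, d i * ((T (inner ℝ (v i) y) - T (inner ℝ (v i) z)) *
        (inner ℝ (v i) y - inner ℝ (v i) z)) = 0 := by
      have h2 : inner ℝ (θ y - θ z) (y - z) = 0 := by rw [hyz, sub_self, inner_zero_left]
      rw [← h2, ← Finset.sum_sub_distrib, sum_inner]
      refine Finset.sum_congr rfl fun i _ => ?_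
      rw [← sub_smul, real_inner_smul_left, inner_sub_right]
      ring
    have hnn : ∀ i, 0 ≤ d i * ((T (inner ℝ (v i) y) - T (inner ℝ (v i) z)) *
        (inner ℝ (v i) y - inner ℝ (v i) z)) := by
      intro i
      refine mul_nonneg (hd i) ?_
      rcases le_total (inner ℝ (v i) y) (inner ℝ (v i) z) with h | h
      · exact mul_nonneg_of_nonpos_of_nonpos
          (sub_nonpos.2 (hmono.monotoneOn (hy i) (hz i) h)) (sub_nonpos.2 h)
      · exact mul_nonneg (sub_nonneg.2 (hmono.monotoneOn (hz i) (hy i) h)) (sub_nonneg.2 h)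
    have h3 := (Finset.sum_eq_zero_iff_of_nonneg fun i _ => hnn i).1 h1
    have h4 : ‖y - z‖ ^ 2 = 0 := by
      rw [← sum_mul_inner_sq_eq_norm_sq hI]
      refine Finset.sum_eq_zero fun i hi => ?_
      rcases mul_eq_zero.1 (h3 i hi) with h | h
      · rw [h, zero_mul]
      · rcases mul_eq_zero.1 h with h | h
        · rw [inner_sub_right, hmono.injOn (hy i) (hz i) (sub_eq_zero.1 h), sub_self]; simp
        · rw [inner_sub_right, h]; simp
    exact sub_eq_zero.1 (norm_eq_zero.1 (pow_eq_zero_iff two_ne_zero |>.1 h4))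
  have hpt : ∀ y ∈ D, ENNReal.ofReal (Real.exp (-∑ i, d i * inner ℝ (v i) y)) ≤
      ENNReal.ofReal |(θ' y).det| * ENNReal.ofReal (Real.exp (-Real.pi * ‖θ y‖ ^ 2)) := by
    intro y hy
    rw [← ENNReal.ofReal_mul (abs_nonneg _)]
    refine ENNReal.ofReal_le_ofReal ?_
    have h1 : Real.exp (-∑ i, d i * inner ℝ (v i) y) =
        (∏ i, T' (inner ℝ (v i) y) ^ d i) *
          Real.exp (-Real.pi * ∑ i, d i * T (inner ℝ (v i) y) ^ 2) := by
      rw [← Finset.sum_neg_distrib, Real.exp_sum, Finset.mul_sum, Real.exp_sum,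
        ← Finset.prod_mul_distrib]
      refine Finset.prod_congr rfl fun i _ => ?_
      have h2 : Real.exp (-(d i * inner ℝ (v i) y)) = Real.exp (-inner ℝ (v i) y) ^ d i := by
        rw [← Real.exp_mul]; congr 1; ring
      rw [h2, hTe _ (hy i), Real.mul_rpow (Real.exp_pos _).le (hT' _ (hy i)).le, ← Real.exp_mul,
        mul_comm]
      congr 2
      ring
    rw [h1]
    have h5 := prod_rpow_le_det_weightedFrame hd (fun i => hT' _ (hy i)) hv hI
    have h6 := norm_sum_smul_sq_le hd hI fun i => T (inner ℝ (v i) y)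
    refine mul_le_mul (h5.trans (le_abs_self _)) (Real.exp_le_exp.2 ?_) (Real.exp_pos _).le
      (abs_nonneg _)
    have := mul_le_mul_of_nonneg_left h6 Real.pi_pos.le
    simp only [θ]
    linarith
  have hgauss : ∫⁻ x : F, ENNReal.ofReal (Real.exp (-Real.pi * ‖x‖ ^ 2)) = 1 := by
    have h := GaussianFourier.integral_rexp_neg_mul_sq_norm (V := F) Real.pi_pos
    rw [div_self Real.pi_ne_zero, Real.one_rpow] at h
    rw [← ofReal_integral_eq_lintegral_ofReal, h, ENNReal.ofReal_one]
    · exact Integrable.of_integral_ne_zero (by rw [h]; exact one_ne_zero)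
    · exact Filter.Eventually.of_forall fun x => (Real.exp_pos _).le
  calc ∫⁻ y in D, ENNReal.ofReal (Real.exp (-∑ i, d i * inner ℝ (v i) y))
      ≤ ∫⁻ y in D, ENNReal.ofReal |(θ' y).det| *
          ENNReal.ofReal (Real.exp (-Real.pi * ‖θ y‖ ^ 2)) := setLIntegral_mono' hDm hpt
    _ = ∫⁻ x in θ '' D, ENNReal.ofReal (Real.exp (-Real.pi * ‖x‖ ^ 2)) :=
        (lintegral_image_eq_lintegral_abs_det_fderiv_mul volume hDm hθ hinj
          fun x => ENNReal.ofReal (Real.exp (-Real.pi * ‖x‖ ^ 2))).symm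
    _ ≤ ∫⁻ x : F, ENNReal.ofReal (Real.exp (-Real.pi * ‖x‖ ^ 2)) := setLIntegral_le_lintegral _ _
    _ = 1 := hgauss

/-- For an orthonormal basis the Brascamp–Lieb inequality for exponential densities is an
equality. -/
theorem lintegral_exp_neg_sum_eq_one (v : OrthonormalBasis ι ℝ F) :
    ∫⁻ y in {y | ∀ i, 0 < inner ℝ (v i) y},
      ENNReal.ofReal (Real.exp (-∑ i, inner ℝ (v i) y)) = 1 := by
  let f : ℝ → ℝ := (Set.Ioi (0 : ℝ)).indicator fun t => Real.exp (-t)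
  have hf0 : ∀ t, 0 ≤ f t := Set.indicator_nonneg fun t _ => (Real.exp_pos _).le
  have hfm : Measurable f := Measurable.indicator (by fun_prop) measurableSet_Ioi
  have hf1 : ∫ x : ι → ℝ, ∏ i, f (x i) = 1 := by
    rw [integral_fintype_prod_volume_eq_pow, integral_indicator measurableSet_Ioi,
      integral_exp_neg_Ioi_zero, one_pow]
  have hDm : MeasurableSet {y : F | ∀ i, 0 < inner ℝ (v i) y} := by
    have : IsOpen {y : F | ∀ i, 0 < inner ℝ (v i) y} := by
      simp only [Set.ofPred_forall]
      exact isOpen_iInter_of_finite fun i => isOpen_lt continuous_const (by fun_prop)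
    exact this.measurableSet
  have hprod : ∀ y : F, ({y : F | ∀ i, 0 < inner ℝ (v i) y}.indicator
      (fun y => ENNReal.ofReal (Real.exp (-∑ i, inner ℝ (v i) y))) y) =
      ENNReal.ofReal (∏ i, f (WithLp.ofLp (v.repr y) i)) := by
    intro y
    simp only [v.repr_apply_apply, f]
    by_cases hy : ∀ i, 0 < inner ℝ (v i) y
    · rw [Set.indicator_of_mem (by exact hy), ← Finset.sum_neg_distrib, Real.exp_sum]
      congr 1
      exact Finset.prod_congr rfl fun i _ => by
        rw [Set.indicator_of_mem (show inner ℝ (v i) y ∈ Set.Ioi (0 : ℝ) from hy i)]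
    · rw [Set.indicator_of_notMem (by exact hy)]
      push Not at hy
      obtain ⟨i, hi⟩ := hy
      have h0 : (Set.Ioi (0 : ℝ)).indicator (fun t => Real.exp (-t)) (inner ℝ (v i) y) = 0 :=
        Set.indicator_of_notMem (not_lt.2 hi) _
      rw [Finset.prod_eq_zero (Finset.mem_univ i) h0, ENNReal.ofReal_zero]
  rw [← lintegral_indicator hDm]
  simp only [hprod]
  have hmp := (EuclideanSpace.volume_preserving_symm_measurableEquiv_toLp ι).comp
    v.measurePreserving_repr
  have hcomp := hmp.lintegral_comp
    (f := fun x : ι → ℝ => ENNReal.ofReal (∏ i, f (x i))) (by fun_prop)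
  refine Eq.trans hcomp ?_
  rw [← ofReal_integral_eq_lintegral_ofReal, hf1, ENNReal.ofReal_one]
  · exact Integrable.of_integral_ne_zero (by rw [hf1]; exact one_ne_zero)
  · exact Filter.Eventually.of_forall fun x => Finset.prod_nonneg fun i _ => hf0 _

end BrascampLieb

/-! ### Lifting to dimension `n + 1` and the volume estimate -/

section Lift

variable {n : ℕ}

/-- The lift `(-√(n / (n + 1)) u, 1 / √(n + 1))` of a vector `u ∈ ℝⁿ` to `ℝⁿ⁺¹`. Unit vectors lift to
unit vectors, and the outer normals of a regular simplex lift to an orthonormal basis. -/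
noncomputable def liftNormal (u : EuclideanSpace ℝ (Fin n)) :
    WithLp 2 (EuclideanSpace ℝ (Fin n) × ℝ) :=
  WithLp.toLp 2 (-√(n / (n + 1)) • u, (√(n + 1))⁻¹)

theorem inner_liftNormal (u : EuclideanSpace ℝ (Fin n))
    (y : WithLp 2 (EuclideanSpace ℝ (Fin n) × ℝ)) :
    inner ℝ (liftNormal u) y = -√(n / (n + 1)) * inner ℝ u y.fst + (√(n + 1))⁻¹ * y.snd := by
  rw [liftNormal, WithLp.prod_inner_apply]
  simp [real_inner_smul_left, mul_comm]

theorem inner_liftNormal_liftNormal (u v : EuclideanSpace ℝ (Fin n)) :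
    inner ℝ (liftNormal u) (liftNormal v) = (n * inner ℝ u v + 1) / (n + 1) := by
  have h1 : √((n : ℝ) / (n + 1)) * √(n / (n + 1)) = n / (n + 1) := Real.mul_self_sqrt (by positivity)
  have h2 : (√((n : ℝ) + 1))⁻¹ * (√(n + 1))⁻¹ = 1 / (n + 1) := by
    rw [← mul_inv, Real.mul_self_sqrt (by positivity), one_div]
  rw [inner_liftNormal]
  simp only [liftNormal, WithLp.toLp_fst, WithLp.toLp_snd, real_inner_smul_right]
  linear_combination inner ℝ u v * h1 + h2

theorem norm_liftNormal {u : EuclideanSpace ℝ (Fin n)} (hu : ‖u‖ = 1) : ‖liftNormal u‖ = 1 := by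
  have h : ‖liftNormal u‖ ^ 2 = 1 := by
    rw [← real_inner_self_eq_norm_sq, inner_liftNormal_liftNormal, real_inner_self_eq_norm_sq, hu]
    field_simp
  exact (pow_eq_one_iff_of_nonneg (norm_nonneg _) two_ne_zero).1 h

/-- A John decomposition of the identity of `ℝⁿ` lifts to one of `ℝⁿ⁺¹`. -/
theorem sum_smul_inner_liftNormal {ι : Type*} [Fintype ι] (hn : 1 ≤ n) {c : ι → ℝ}
    {u : ι → EuclideanSpace ℝ (Fin n)} (hc : ∑ i, c i = n) (hcu : ∑ i, c i • u i = 0)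
    (hI : ∀ x, ∑ i, c i • inner ℝ (u i) x • u i = x)
    (y : WithLp 2 (EuclideanSpace ℝ (Fin n) × ℝ)) :
    ∑ i, ((n + 1) / n * c i) • inner ℝ (liftNormal (u i)) y • liftNormal (u i) = y := by
  have hn0 : (0 : ℝ) < n := by exact_mod_cast hn
  set a := √((n : ℝ) / (n + 1)) with ha
  set b := (√((n : ℝ) + 1))⁻¹ with hb
  have h1 : a * a = n / (n + 1) := Real.mul_self_sqrt (by positivity)
  have h2 : b * b = 1 / (n + 1) := by
    rw [hb, ← mul_inv, Real.mul_self_sqrt (by positivity), one_div]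
  have hcx : ∑ i, c i * inner ℝ (u i) y.fst = 0 := by
    have := congrArg (fun z => inner ℝ z y.fst) hcu
    simpa [sum_inner, real_inner_smul_left] using this
  apply (WithLp.ofLp_injective 2)
  refine Prod.ext ?_ ?_
  · simp only [WithLp.ofLp_sum, WithLp.ofLp_smul, Prod.fst_sum, Prod.smul_fst, inner_liftNormal]
    have : ∀ i, ((n + 1) / n * c i) • (-a * inner ℝ (u i) y.fst + b * y.snd) •
        (liftNormal (u i)).ofLp.1 = c i • inner ℝ (u i) y.fst • u i -
          ((n + 1) / n * a * b * y.snd) • (c i • u i) := by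
      intro i
      simp only [liftNormal, smul_smul, ← ha]
      rw [← sub_smul]
      congr 1
      have h3 : ((n : ℝ) + 1) / n * (a * a) = 1 := by rw [h1]; field_simp
      linear_combination c i * inner ℝ (u i) y.fst * h3
    rw [Finset.sum_congr rfl fun i _ => this i, Finset.sum_sub_distrib, ← Finset.smul_sum, hcu, hI,
      smul_zero, sub_zero]
    rfl
  · simp only [WithLp.ofLp_sum, WithLp.ofLp_smul, Prod.snd_sum, Prod.smul_snd, inner_liftNormal]
    have : ∀ i, ((n + 1) / n * c i) • (-a * inner ℝ (u i) y.fst + b * y.snd) •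
        (liftNormal (u i)).ofLp.2 = (y.snd / n) * c i -
          ((n + 1) / n * a * b) * (c i * inner ℝ (u i) y.fst) := by
      intro i
      simp only [liftNormal, smul_eq_mul, ← hb]
      have h3 : ((n : ℝ) + 1) * (b * b) = 1 := by rw [h2]; field_simp
      linear_combination (y.snd / n) * c i * h3
    rw [Finset.sum_congr rfl fun i _ => this i, Finset.sum_sub_distrib, ← Finset.mul_sum,
      ← Finset.mul_sum, hcx, hc, mul_zero, sub_zero, div_mul_cancel₀ _ hn0.ne']
    rfl

/-- The integral of `exp (-√(n + 1) y)`, `y` the last coordinate, over a cone in `ℝⁿ⁺¹` whose section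
at height `√n` has volume `1`. Only its being the same for all John decompositions matters. -/
noncomputable def coneConstant (n : ℕ) : ENNReal :=
  ∫⁻ r in Set.Ioi (0 : ℝ), ENNReal.ofReal (Real.exp (-((n + 1) * (√((n : ℝ) + 1))⁻¹ * r))) *
    ENNReal.ofReal ((r * ((√((n : ℝ) + 1))⁻¹ / √(n / (n + 1)))) ^ n)

open scoped Pointwise in
/-- The exponential integral over the cone `{y | ∀ i, 0 < ⟪liftNormal (u i), y⟫}` in `ℝⁿ⁺¹` computes
the volume of its horizontal sections, which are dilates of `{x | ∀ i, ⟪u i, x⟫ < 1}`. -/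
theorem lintegral_cone_eq {ι : Type*} [Fintype ι] (hn : 1 ≤ n) {c : ι → ℝ}
    {u : ι → EuclideanSpace ℝ (Fin n)} (hc0 : ∀ i, 0 ≤ c i) (hc : ∑ i, c i = n)
    (hcu : ∑ i, c i • u i = 0) :
    ∫⁻ y in {y | ∀ i, 0 < inner ℝ (liftNormal (u i)) y},
      ENNReal.ofReal (Real.exp (-∑ i, ((n + 1) / n * c i) * inner ℝ (liftNormal (u i)) y)) =
    coneConstant n * volume {x : EuclideanSpace ℝ (Fin n) | ∀ i, inner ℝ (u i) x < 1} := by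
  have hn0 : (0 : ℝ) < n := by exact_mod_cast hn
  set a := √((n : ℝ) / (n + 1)) with ha
  set b := (√((n : ℝ) + 1))⁻¹ with hb
  have ha0 : 0 < a := Real.sqrt_pos.2 (by positivity)
  have hb0 : 0 < b := inv_pos.2 (Real.sqrt_pos.2 (by positivity))
  have hcx : ∀ x, ∑ i, c i * inner ℝ (u i) x = 0 := by
    intro x
    have := congrArg (fun z => inner ℝ z x) hcu
    simpa [sum_inner, real_inner_smul_left] using this
  set K := {x : EuclideanSpace ℝ (Fin n) | ∀ i, inner ℝ (u i) x < 1} with hK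
  let D : Set (EuclideanSpace ℝ (Fin n) × ℝ) := {p | ∀ i, 0 < -a * inner ℝ (u i) p.1 + b * p.2}
  have hD : MeasurableSet D := by
    have : IsOpen D := by
      simp only [D, Set.ofPred_forall]
      exact isOpen_iInter_of_finite fun i => isOpen_lt continuous_const (by fun_prop)
    exact this.measurableSet
  let G : EuclideanSpace ℝ (Fin n) × ℝ → ENNReal :=
    D.indicator fun p => ENNReal.ofReal (Real.exp (-((n + 1) * b * p.2)))
  have hG : Measurable G := Measurable.indicator (by fun_prop) hD
  have hDm : MeasurableSet {y : WithLp 2 (EuclideanSpace ℝ (Fin n) × ℝ) |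
      ∀ i, 0 < inner ℝ (liftNormal (u i)) y} := by
    have : IsOpen {y : WithLp 2 (EuclideanSpace ℝ (Fin n) × ℝ) |
        ∀ i, 0 < inner ℝ (liftNormal (u i)) y} := by
      simp only [Set.ofPred_forall]
      exact isOpen_iInter_of_finite fun i => isOpen_lt continuous_const (by fun_prop)
    exact this.measurableSet
  have hsum : ∀ y : WithLp 2 (EuclideanSpace ℝ (Fin n) × ℝ),
      ∑ i, ((n + 1) / n * c i) * inner ℝ (liftNormal (u i)) y = (n + 1) * b * y.snd := by
    intro y
    have h : ∀ i, ((n + 1) / n * c i) * inner ℝ (liftNormal (u i)) y =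
        -((n + 1) / n * a) * (c i * inner ℝ (u i) y.fst) + ((n + 1) / n * b * y.snd) * c i := by
      intro i
      rw [inner_liftNormal]
      ring
    rw [Finset.sum_congr rfl fun i _ => h i, Finset.sum_add_distrib, ← Finset.mul_sum,
      ← Finset.mul_sum, hcx, hc]
    field_simp
    ring
  have hlhs : ∀ y : WithLp 2 (EuclideanSpace ℝ (Fin n) × ℝ),
      {y | ∀ i, 0 < inner ℝ (liftNormal (u i)) y}.indicator (fun y => ENNReal.ofReal
        (Real.exp (-∑ i, ((n + 1) / n * c i) * inner ℝ (liftNormal (u i)) y))) y =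
      G (WithLp.ofLp y) := by
    intro y
    have hiff : y ∈ {y | ∀ i, 0 < inner ℝ (liftNormal (u i)) y} ↔ WithLp.ofLp y ∈ D := by
      refine forall_congr' fun i => ?_
      rw [inner_liftNormal]
      rfl
    by_cases hy : WithLp.ofLp y ∈ D
    · rw [Set.indicator_of_mem (hiff.2 hy), hsum]
      simp only [G]
      rw [Set.indicator_of_mem hy]
      rfl
    · rw [Set.indicator_of_notMem (fun h => hy (hiff.1 h))]
      simp only [G]
      rw [Set.indicator_of_notMem hy]
  rw [← lintegral_indicator hDm, lintegral_congr hlhs,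
    (WithLp.volume_preserving_ofLp (EuclideanSpace ℝ (Fin n)) ℝ).lintegral_comp hG,
    Measure.volume_eq_prod, lintegral_prod_symm' _ hG, coneConstant, ← lintegral_mul_const _
    (by fun_prop), ← lintegral_indicator measurableSet_Ioi]
  refine lintegral_congr fun r => ?_
  have hslice : ∀ x, G (x, r) = {x | (x, r) ∈ D}.indicator
      (fun _ => ENNReal.ofReal (Real.exp (-((n + 1) * b * r)))) x := fun x => rfl
  simp only [hslice]
  have hDr : MeasurableSet {x | (x, r) ∈ D} := measurable_prodMk_right hD
  rw [lintegral_indicator_const hDr]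
  by_cases hr : r ∈ Set.Ioi (0 : ℝ)
  · have hr0 : 0 < r := hr
    have ht : 0 < r * (b / a) := by positivity
    have hset : {x | (x, r) ∈ D} = (r * (b / a)) • K := by
      ext x
      rw [Set.mem_smul_set_iff_inv_smul_mem₀ ht.ne']
      refine forall_congr' fun i => ?_
      rw [inner_smul_right, inv_mul_lt_iff₀ ht, mul_one, ← mul_div_assoc, lt_div_iff₀ ha0]
      constructor <;> intro h <;> linarith
    rw [hset, Measure.addHaar_smul, finrank_euclideanSpace_fin, Set.indicator_of_mem hr,
      abs_of_pos (by positivity)]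
    exact (mul_assoc _ _ _).symm
  · rw [Set.indicator_of_notMem hr]
    -- Below height `0` the sections are empty, because the `uᵢ` are balanced.
    have hset : {x | (x, r) ∈ D} = ∅ := by
      refine Set.eq_empty_of_forall_notMem fun x hx => ?_
      have h1 : 0 < ∑ i, c i * (-a * inner ℝ (u i) x + b * r) := by
        obtain ⟨i, -, hi⟩ : ∃ i ∈ Finset.univ, 0 < c i := by
          refine Finset.exists_lt_of_sum_lt (f := fun _ => (0 : ℝ)) ?_
          simpa [hc] using hn0
        exact Finset.sum_pos' (fun i _ => mul_nonneg (hc0 i) (hx i).le)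
          ⟨i, Finset.mem_univ _, mul_pos hi (hx i)⟩
      have h2 : ∑ i, c i * (-a * inner ℝ (u i) x + b * r) = b * r * n := by
        have h : ∀ i, c i * (-a * inner ℝ (u i) x + b * r) =
            -a * (c i * inner ℝ (u i) x) + b * r * c i := fun i => by ring
        rw [Finset.sum_congr rfl fun i _ => h i, Finset.sum_add_distrib, ← Finset.mul_sum,
          ← Finset.mul_sum, hcx, hc, mul_zero, zero_add]
      have h3 : b * r * n ≤ 0 :=
        mul_nonpos_of_nonpos_of_nonneg (mul_nonpos_of_nonneg_of_nonpos hb0.le (not_lt.1 hr)) hn0.le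
      linarith
    rw [hset, measure_empty, mul_zero]

end Lift

section SimplexNormals

variable {n : ℕ}

/-- `w` is the family of outer unit normals of a regular simplex in `ℝⁿ`: `n + 1` unit vectors with pairwise inner
products `-1 / n`. -/
def IsSimplexNormals (w : Fin (n + 1) → EuclideanSpace ℝ (Fin n)) : Prop :=
  ∀ i j, inner ℝ (w i) (w j) = if i = j then (1 : ℝ) else -1 / n

variable {w : Fin (n + 1) → EuclideanSpace ℝ (Fin n)}

theorem IsSimplexNormals.norm_eq (hw : IsSimplexNormals w) (i : Fin (n + 1)) : ‖w i‖ = 1 := by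
  have h := hw i i
  rw [if_pos rfl, real_inner_self_eq_norm_sq] at h
  exact (pow_eq_one_iff_of_nonneg (norm_nonneg _) two_ne_zero).1 h

theorem IsSimplexNormals.sum_eq_zero (hn : 1 ≤ n) (hw : IsSimplexNormals w) : ∑ i, w i = 0 := by
  have hn0 : (0 : ℝ) < n := by exact_mod_cast hn
  rw [← inner_self_eq_zero (𝕜 := ℝ), sum_inner]
  refine Finset.sum_eq_zero fun i _ => ?_
  have h : ∀ j, inner ℝ (w i) (w j) = -1 / n + if i = j then (1 + 1 / n : ℝ) else 0 := by
    intro j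
    rw [hw]
    split_ifs <;> ring
  rw [inner_sum, Finset.sum_congr rfl fun j _ => h j, Finset.sum_add_distrib]
  simp
  field_simp
  ring

theorem IsSimplexNormals.exists_orthonormalBasis (hn : 1 ≤ n) (hw : IsSimplexNormals w) :
    ∃ v : OrthonormalBasis (Fin (n + 1)) ℝ (WithLp 2 (EuclideanSpace ℝ (Fin n) × ℝ)),
      ∀ i, v i = liftNormal (w i) := by
  have hn0 : (0 : ℝ) < n := by exact_mod_cast hn
  have hon : Orthonormal ℝ fun i => liftNormal (w i) := by
    rw [orthonormal_iff_ite]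
    intro i j
    rw [inner_liftNormal_liftNormal, hw]
    split_ifs
    · field_simp
    · field_simp; ring
  have hrank : Module.finrank ℝ (WithLp 2 (EuclideanSpace ℝ (Fin n) × ℝ)) =
      Fintype.card (Fin (n + 1)) := by
    rw [(WithLp.linearEquiv 2 ℝ (EuclideanSpace ℝ (Fin n) × ℝ)).finrank_eq]
    simp
  obtain ⟨v, hv⟩ := Orthonormal.exists_orthonormalBasis_extension_of_card_eq hrank
    (v := fun i => liftNormal (w i)) (s := Set.univ) (hon.comp _ Subtype.val_injective)
  exact ⟨v, fun i => hv i trivial⟩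

theorem IsSimplexNormals.sum_inner_smul (hn : 1 ≤ n) (hw : IsSimplexNormals w)
    (x : EuclideanSpace ℝ (Fin n)) :
    ∑ i, inner ℝ (w i) x • w i = (((n : ℝ) + 1) / n) • x := by
  have hn0 : (0 : ℝ) < n := by exact_mod_cast hn
  obtain ⟨v, hv⟩ := hw.exists_orthonormalBasis hn
  have h := congrArg (fun z => (WithLp.ofLp z).1) (v.sum_repr' (WithLp.toLp 2 (x, (0 : ℝ))))
  simp only [hv, inner_liftNormal, WithLp.ofLp_sum, WithLp.ofLp_smul, Prod.fst_sum, Prod.smul_fst,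
    WithLp.toLp_fst, WithLp.toLp_snd, mul_zero, add_zero] at h
  conv_rhs => rw [← h]
  rw [Finset.smul_sum]
  refine Finset.sum_congr rfl fun i _ => ?_
  simp only [liftNormal, smul_smul]
  congr 1
  have h1 : √((n : ℝ) / (n + 1)) * √(n / (n + 1)) = n / (n + 1) := Real.mul_self_sqrt (by positivity)
  have h3 : ((n : ℝ) + 1) / n * (√((n : ℝ) / (n + 1)) * √(n / (n + 1))) = 1 := by
    rw [h1]; field_simp
  linear_combination - inner ℝ (w i) x * h3

theorem IsSimplexNormals.eq_zero_of_inner_nonpos (hn : 1 ≤ n) (hw : IsSimplexNormals w)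
    (x : EuclideanSpace ℝ (Fin n)) (hx : ∀ i, inner ℝ (w i) x ≤ 0) : x = 0 := by
  have hn0 : (0 : ℝ) < n := by exact_mod_cast hn
  have h0 : ∑ i, inner ℝ (w i) x = 0 := by
    rw [← sum_inner, hw.sum_eq_zero hn, inner_zero_left]
  have h1 := (Finset.sum_eq_zero_iff_of_nonpos fun i _ => hx i).1 h0
  have h2 := hw.sum_inner_smul hn x
  rw [Finset.sum_eq_zero fun i hi => by rw [h1 i hi, zero_smul]] at h2
  exact (smul_eq_zero.1 h2.symm).resolve_left (by positivity)

/-- Among the convex sets contained in the half-spaces `⟪uᵢ, x⟫ ≤ 1` of a John decomposition, the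
regular simplex with inradius `1` has the largest volume: the Brascamp–Lieb inequality on the cone in `ℝⁿ⁺¹` is an
equality for the simplex, whose lifted normals are orthonormal. -/
theorem volume_le_volume_polyhedron (hn : 1 ≤ n) (hw : IsSimplexNormals w)
    {C : Set (EuclideanSpace ℝ (Fin n))} (hC : Convex ℝ C)
    {ι : Type*} [Fintype ι] {c : ι → ℝ} {u : ι → EuclideanSpace ℝ (Fin n)}
    (hc0 : ∀ i, 0 ≤ c i) (hu : ∀ i, ‖u i‖ = 1) (huC : ∀ i, ∀ x ∈ C, inner ℝ (u i) x ≤ 1)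
    (hc : ∑ i, c i = n) (hcu : ∑ i, c i • u i = 0)
    (hI : ∀ x, ∑ i, c i • inner ℝ (u i) x • u i = x) :
    volume C ≤ volume (polyhedron w) := by
  have hn0 : (0 : ℝ) < n := by exact_mod_cast hn
  have h1 : coneConstant n * volume {x : EuclideanSpace ℝ (Fin n) | ∀ i, inner ℝ (u i) x < 1} ≤ 1 := by
    rw [← lintegral_cone_eq hn hc0 hc hcu]
    refine lintegral_exp_neg_sum_le_one (fun i => ?_) (fun i => norm_liftNormal (hu i))
      (sum_smul_inner_liftNormal hn hc hcu hI)
    have := hc0 i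
    positivity
  have h2 : coneConstant n * volume {x : EuclideanSpace ℝ (Fin n) | ∀ i, inner ℝ (w i) x < 1} = 1 := by
    have hone : ((n : ℝ) + 1) / n * (n / (n + 1)) = 1 := by field_simp
    rw [← lintegral_cone_eq hn (c := fun _ => (n : ℝ) / (n + 1)) (fun i => by positivity)
      (by simp; field_simp) (by rw [← Finset.smul_sum, hw.sum_eq_zero hn, smul_zero])]
    obtain ⟨v, hv⟩ := hw.exists_orthonormalBasis hn
    simp only [← hv, hone, one_mul]
    exact lintegral_exp_neg_sum_eq_one v
  have hk0 : coneConstant n ≠ 0 := by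
    intro h; rw [h, zero_mul] at h2; exact zero_ne_one h2
  have hk1 : coneConstant n ≠ ⊤ := by
    intro h
    rw [h, ENNReal.top_mul'] at h2
    split_ifs at h2
    · exact zero_ne_one h2
    · exact ENNReal.top_ne_one h2
  have h3 : volume {x : EuclideanSpace ℝ (Fin n) | ∀ i, inner ℝ (u i) x < 1} ≤
      volume {x : EuclideanSpace ℝ (Fin n) | ∀ i, inner ℝ (w i) x < 1} :=
    (ENNReal.mul_le_mul_iff_right hk0 hk1).1 (h1.trans_eq h2.symm)
  have h4 : interior C ⊆ {x | ∀ i, inner ℝ (u i) x < 1} := by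
    intro x hx i
    have hcont : ContinuousAt (fun t : ℝ => x + t • u i) 0 := by fun_prop
    have hev : ∀ᶠ t in nhds (0 : ℝ), x + t • u i ∈ C :=
      hcont.eventually (by simpa using mem_interior_iff_mem_nhds.1 hx)
    obtain ⟨t, ht, ht0⟩ := ((hev.filter_mono nhdsWithin_le_nhds).and
      (self_mem_nhdsWithin (s := Set.Ioi (0 : ℝ)))).exists
    have := huC i _ ht
    rw [inner_add_right, inner_smul_right, real_inner_self_eq_norm_sq, hu i] at this
    have ht0' : 0 < t := ht0
    linarith
  calc volume C = volume (interior C) := by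
        refine le_antisymm ?_ (measure_mono interior_subset)
        refine (measure_mono subset_closure).trans ?_
        rw [closure_eq_interior_union_frontier]
        refine (measure_union_le _ _).trans_eq ?_
        rw [hC.addHaar_frontier volume, add_zero]
    _ ≤ volume {x : EuclideanSpace ℝ (Fin n) | ∀ i, inner ℝ (u i) x < 1} := measure_mono h4
    _ ≤ volume {x : EuclideanSpace ℝ (Fin n) | ∀ i, inner ℝ (w i) x < 1} := h3
    _ ≤ volume (polyhedron w) := measure_mono fun x hx i => (hx i).le

end SimplexNormals

/-! ### Regular simplices -/

section RegularSimplex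

variable {n : ℕ}

/-- A regular simplex is a translated dilate of the polyhedron cut out by its outer unit normals.
The dilation factor is the inradius. -/
theorem Affine.Simplex.Regular.exists_isSimplexNormals (hn : 1 ≤ n)
    {T : Affine.Simplex ℝ (EuclideanSpace ℝ (Fin n)) n} (hT : T.Regular) :
    ∃ (c : EuclideanSpace ℝ (Fin n)) (r : ℝ) (w : Fin (n + 1) → EuclideanSpace ℝ (Fin n)),
      0 < r ∧ IsSimplexNormals w ∧
        T.closedInterior = (fun x => c + r • x) '' polyhedron w := by
  have hn0 : (0 : ℝ) < n := by exact_mod_cast hn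
  obtain ⟨s, hs⟩ := hT.equilateral
  have hne01 : (0 : Fin (n + 1)) ≠ Fin.last n := by
    rw [Ne, Fin.ext_iff]; simp; omega
  have hs0 : 0 < s := by
    rw [← hs _ _ hne01, dist_pos]
    exact T.independent.injective.ne hne01
  set c : EuclideanSpace ℝ (Fin n) := ((n : ℝ) + 1)⁻¹ • ∑ i, T.points i with hc
  set q : Fin (n + 1) → EuclideanSpace ℝ (Fin n) := fun i => T.points i - c with hq
  have hqsum : ∑ i, q i = 0 := by
    simp only [hq, Finset.sum_sub_distrib, Finset.sum_const, Finset.card_univ, Fintype.card_fin, hc]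
    rw [← Nat.cast_smul_eq_nsmul ℝ, smul_smul]
    push_cast
    rw [mul_inv_cancel₀ (by positivity), one_smul, sub_self]
  have hqd : ∀ i j, ‖q i‖ ^ 2 - 2 * inner ℝ (q i) (q j) + ‖q j‖ ^ 2 =
      s ^ 2 - if i = j then s ^ 2 else 0 := by
    intro i j
    rw [← norm_sub_sq_real]
    have : q i - q j = T.points i - T.points j := by simp [hq]
    rw [this, ← dist_eq_norm]
    split_ifs with h
    · simp [h]
    · rw [hs i j h, sub_zero]
  have hnorm : ∀ i, ((n : ℝ) + 1) * ‖q i‖ ^ 2 + ∑ j, ‖q j‖ ^ 2 = n * s ^ 2 := by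
    intro i
    have h := Finset.sum_congr rfl fun j (_ : j ∈ Finset.univ) => hqd i j
    simp only [Finset.sum_add_distrib, Finset.sum_sub_distrib, ← Finset.mul_sum, ← inner_sum, hqsum,
      inner_zero_right, Finset.sum_const, Finset.card_univ, Fintype.card_fin, nsmul_eq_mul,
      Finset.sum_ite_eq, Finset.mem_univ, if_true] at h
    push_cast at h
    linarith
  have htot : ∑ j, ‖q j‖ ^ 2 = n * s ^ 2 / 2 := by
    have h := Finset.sum_congr rfl fun j (_ : j ∈ Finset.univ) => hnorm j
    simp only [Finset.sum_add_distrib, ← Finset.mul_sum, Finset.sum_const, Finset.card_univ,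
      Fintype.card_fin, nsmul_eq_mul] at h
    push_cast at h
    have h1 : ((n : ℝ) + 1) * (2 * ∑ j, ‖q j‖ ^ 2) = (n + 1) * (n * s ^ 2) := by linarith
    have := mul_left_cancel₀ (by positivity) h1
    linarith
  set R := √(n * s ^ 2 / (2 * (n + 1))) with hR
  have hR0 : 0 < R := Real.sqrt_pos.2 (by positivity)
  have hRsq : R ^ 2 = n * s ^ 2 / (2 * (n + 1)) := Real.sq_sqrt (by positivity)
  have hqn : ∀ i, ‖q i‖ ^ 2 = R ^ 2 := by
    intro i
    have := hnorm i
    rw [htot] at this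
    rw [hRsq]
    field_simp
    linarith
  have hgram : ∀ i j, inner ℝ (q i) (q j) = R ^ 2 * if i = j then (1 : ℝ) else -1 / n := by
    intro i j
    have h := hqd i j
    rw [hqn, hqn] at h
    split_ifs at h ⊢
    · linarith
    · have hs2 : s ^ 2 = 2 * (n + 1) / n * R ^ 2 := by rw [hRsq]; field_simp
      rw [hs2] at h
      field_simp at h ⊢
      linarith
  set w : Fin (n + 1) → EuclideanSpace ℝ (Fin n) := fun i => -(R⁻¹ • q i) with hw
  have hwN : IsSimplexNormals w := by
    intro i j
    simp only [hw, inner_neg_neg, real_inner_smul_left, real_inner_smul_right, hgram]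
    field_simp
  have hqw : ∀ i, T.points i = c - R • w i := by
    intro i
    simp [hw, hq, smul_smul, hR0.ne']
  have hwsum := hwN.sum_eq_zero hn
  refine ⟨c, R / n, w, by positivity, hwN, ?_⟩
  rw [← Affine.Simplex.convexHull_eq_closedInterior]
  apply Set.Subset.antisymm
  · refine convexHull_min ?_ ?_
    -- The vertex opposite to the `j`-th facet lies in direction `-w j`, at `n` times the inradius.
    · rintro _ ⟨j, rfl⟩
      refine ⟨-(n : ℝ) • w j, fun i => ?_, ?_⟩
      · rw [real_inner_smul_right, hwN]
        split_ifs
        · linarith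
        · field_simp; norm_num
      · simp only [hqw, smul_smul]
        rw [mul_neg, div_mul_cancel₀ _ hn0.ne', neg_smul, sub_eq_add_neg]
    · have : (fun x => c + (R / n) • x) '' polyhedron w =
          (fun x => c + x) '' ((fun x => (R / n) • x) '' polyhedron w) := by
        rw [Set.image_image]
      rw [this]
      exact ((convex_polyhedron w).smul (R / n)).translate c
  -- The barycentric coordinates of a point are affine in its distances from the facets.
  · rintro _ ⟨x, hx, rfl⟩
    refine mem_convexHull_of_exists_fintype (fun i => ((n : ℝ) + 1)⁻¹ * (1 - inner ℝ (w i) x))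
      T.points (fun i => mul_nonneg (by positivity) (sub_nonneg.2 (hx i))) ?_
      (fun i => Set.mem_range_self i) ?_
    · rw [← Finset.mul_sum, Finset.sum_sub_distrib, ← sum_inner, hwsum, inner_zero_left]
      simp
      field_simp
    · have h : ∀ i, (((n : ℝ) + 1)⁻¹ * (1 - inner ℝ (w i) x)) • T.points i =
          ((n : ℝ) + 1)⁻¹ • c - (((n : ℝ) + 1)⁻¹ * inner ℝ (w i) x) • c
            - (((n : ℝ) + 1)⁻¹ * R) • w i + (((n : ℝ) + 1)⁻¹ * R) • (inner ℝ (w i) x • w i) := by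
        intro i
        rw [hqw]
        module
      have hwx : ∑ i, ((n : ℝ) + 1)⁻¹ * inner ℝ (w i) x = 0 := by
        rw [← Finset.mul_sum, ← sum_inner, hwsum, inner_zero_left, mul_zero]
      rw [Finset.sum_congr rfl fun i _ => h i]
      simp only [Finset.sum_add_distrib, Finset.sum_sub_distrib, ← Finset.smul_sum, ← Finset.sum_smul,
        hwx, hwsum, hwN.sum_inner_smul hn]
      simp only [Finset.sum_const, Finset.card_univ, Fintype.card_fin, smul_zero, zero_smul, sub_zero]
      have h1 : ((n : ℝ) + 1)⁻¹ • ((n + 1) • c) = c := by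
        rw [← Nat.cast_smul_eq_nsmul ℝ, smul_smul]
        push_cast
        rw [inv_mul_cancel₀ (by positivity), one_smul]
      have h2 : (((n : ℝ) + 1)⁻¹ * R) • (((n : ℝ) + 1) / n) • x = (R / n) • x := by
        rw [smul_smul]
        congr 1
        field_simp
      rw [h1, h2]

end RegularSimplex

section Scaling

open scoped Pointwise

variable {n : ℕ}

theorem volume_image_add_smul (c : EuclideanSpace ℝ (Fin n)) {r : ℝ} (hr : 0 < r)
    (P : Set (EuclideanSpace ℝ (Fin n))) :
    volume ((fun x => c + r • x) '' P) = ENNReal.ofReal (r ^ n) * volume P := by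
  have : (fun x => c + r • x) '' P = c +ᵥ r • P := by
    ext y; simp [Set.mem_vadd_set, Set.mem_smul_set]
  rw [this, measure_vadd, Measure.addHaar_smul, finrank_euclideanSpace_fin,
    abs_of_pos (by positivity)]

theorem surfaceArea_image_add_smul (c : EuclideanSpace ℝ (Fin n)) {r : ℝ} (hr : 0 < r)
    (P : Set (EuclideanSpace ℝ (Fin n))) :
    surfaceArea ((fun x => c + r • x) '' P) = ENNReal.ofReal (r ^ (n - 1)) * surfaceArea P := by
  have himg : ∀ Q : Set (EuclideanSpace ℝ (Fin n)),
      (fun x => c + r • x) '' Q = c +ᵥ r • Q := fun Q => by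
    ext y; simp [Set.mem_vadd_set, Set.mem_smul_set]
  have hfr : frontier ((fun x => c + r • x) '' P) = (fun x => c + r • x) '' frontier P :=
    (((Homeomorph.smulOfNeZero r hr.ne').trans (Homeomorph.addLeft c)).image_frontier P).symm
  rw [surfaceArea, surfaceArea, hfr, himg, measure_vadd,
    Measure.euclideanHausdorffMeasure_smul₀ _ hr.ne', ENNReal.smul_def, smul_eq_mul,
    ENNReal.coe_pow, ENNReal.ofReal_pow hr.le, ← enorm_eq_nnnorm, Real.enorm_of_nonneg hr.le]

end Scaling

/-! ### The reverse isoperimetric inequality -/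

theorem theorem1 (n : ℕ) (hn : 1 ≤ n)
    (C : ConvexBody (EuclideanSpace ℝ (Fin n)))
    (hC : (interior (C : Set (EuclideanSpace ℝ (Fin n)))).Nonempty)
    (T : Affine.Simplex ℝ (EuclideanSpace ℝ (Fin n)) n) (hT : T.Regular) :
    ∃ φ : EuclideanSpace ℝ (Fin n) ≃ᵃ[ℝ] EuclideanSpace ℝ (Fin n),
      volume (φ '' (C : Set (EuclideanSpace ℝ (Fin n)))) = volume T.closedInterior ∧
      surfaceArea (φ '' (C : Set (EuclideanSpace ℝ (Fin n)))) ≤ surfaceArea T.closedInterior ∧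
      isoperimetricRatio (φ '' (C : Set (EuclideanSpace ℝ (Fin n)))) ≤
        isoperimetricRatio T.closedInterior := by
  obtain ⟨ψ, hB, hmax⟩ := exists_affineEquiv_closedBall_maximal C.isCompact hC
  obtain ⟨p, r, w, hr, hw, hTw⟩ := hT.exists_isSimplexNormals hn
  set D : Set (EuclideanSpace ℝ (Fin n)) := ψ '' C with hD
  have hDconv : Convex ℝ D := C.convex.affine_image ψ.toAffineMap
  have hDc : IsCompact D := C.isCompact.image ψ.continuous_of_finiteDimensional
  obtain ⟨ι, _, c, u, hc0, hu, huD, hc, hcu, hI⟩ :=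
    exists_john_decomposition hn hDconv hDc.isClosed hB hmax
  have hvol : volume D ≤ volume (polyhedron w) :=
    volume_le_volume_polyhedron hn hw hDconv hc0 hu huD hc hcu hI
  have hsurfD : surfaceArea D ≤ n * volume D := surfaceArea_le_of_closedBall_subset hn hDconv hDc hB
  have hsurfT : n * volume (polyhedron w) ≤ surfaceArea (polyhedron w) :=
    le_surfaceArea_polyhedron w hn hw.norm_eq (hw.eq_zero_of_inner_nonpos hn)
  have hWtop : volume (polyhedron w) ≠ ⊤ := by
    intro htop
    have h : volume T.closedInterior ≠ ⊤ := T.isCompact_closedInterior.measure_ne_top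
    rw [hTw, volume_image_add_smul p hr, htop, ENNReal.mul_top] at h
    · exact h rfl
    · simpa using pow_pos hr n
  have hDtop : volume D ≠ ⊤ := hDc.measure_ne_top
  have hDpos : volume D ≠ 0 := ((Metric.measure_closedBall_pos volume _ one_pos).trans_le
    (measure_mono hB)).ne'
  set V := (volume D).toReal with hV
  set W := (volume (polyhedron w)).toReal with hW
  have hVpos : 0 < V := ENNReal.toReal_pos hDpos hDtop
  have hVW : V ≤ W := ENNReal.toReal_mono hWtop hvol
  have hVof : volume D = ENNReal.ofReal V := (ENNReal.ofReal_toReal hDtop).symm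
  have hWof : volume (polyhedron w) = ENNReal.ofReal W := (ENNReal.ofReal_toReal hWtop).symm
  have hWpos : 0 < W := hVpos.trans_le hVW
  have hn0 : n ≠ 0 := by omega
  -- The dilation factor that makes the volumes equal; it is at least the inradius `r` of `T`.
  set l := r * (W / V) ^ ((n : ℝ)⁻¹) with hl
  have hrl : r ≤ l := by
    refine le_mul_of_one_le_right hr.le (Real.one_le_rpow ?_ (by positivity))
    rwa [one_le_div hVpos]
  have hl0 : 0 < l := hr.trans_le hrl
  have hln : l ^ n * V = r ^ n * W := by
    rw [hl, mul_pow, Real.rpow_inv_natCast_pow (by positivity) hn0]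
    field_simp
  let φ : EuclideanSpace ℝ (Fin n) ≃ᵃ[ℝ] EuclideanSpace ℝ (Fin n) :=
    ψ.trans (LinearEquiv.smulOfNeZero ℝ _ l hl0.ne').toAffineEquiv
  have hφ : φ '' (C : Set (EuclideanSpace ℝ (Fin n))) = (fun x => 0 + l • x) '' D := by
    rw [hD, Set.image_image]
    exact Set.image_congr fun x _ => (zero_add _).symm
  have hveq : volume (φ '' (C : Set (EuclideanSpace ℝ (Fin n)))) = volume T.closedInterior := by
    rw [hφ, hTw, volume_image_add_smul _ hl0, volume_image_add_smul _ hr, hVof, hWof,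
      ← ENNReal.ofReal_mul (by positivity), ← ENNReal.ofReal_mul (by positivity), hln]
  have hsle : surfaceArea (φ '' (C : Set (EuclideanSpace ℝ (Fin n)))) ≤
      surfaceArea T.closedInterior := by
    rw [hφ, hTw, surfaceArea_image_add_smul _ hl0, surfaceArea_image_add_smul _ hr]
    -- Dividing the common volume `l ^ n * V = r ^ n * W` by `l` gives no more than dividing it by `r`.
    have hkey : l ^ (n - 1) * V ≤ r ^ (n - 1) * W := by
      have h1 : l * (l ^ (n - 1) * V) = r * (r ^ (n - 1) * W) := by
        rw [← mul_assoc, ← mul_assoc, mul_pow_sub_one hn0, mul_pow_sub_one hn0, hln]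
      have h2 : r * (r ^ (n - 1) * W) ≤ l * (r ^ (n - 1) * W) := by gcongr
      exact le_of_mul_le_mul_left (h1.trans_le h2) hl0
    calc ENNReal.ofReal (l ^ (n - 1)) * surfaceArea D
        ≤ ENNReal.ofReal (l ^ (n - 1)) * (n * volume D) := by gcongr
      _ = n * ENNReal.ofReal (l ^ (n - 1) * V) := by
          rw [ENNReal.ofReal_mul (by positivity), hVof]; ring
      _ ≤ n * ENNReal.ofReal (r ^ (n - 1) * W) := by gcongr
      _ = ENNReal.ofReal (r ^ (n - 1)) * (n * volume (polyhedron w)) := by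
          rw [ENNReal.ofReal_mul (by positivity), hWof]; ring
      _ ≤ ENNReal.ofReal (r ^ (n - 1)) * surfaceArea (polyhedron w) := by gcongr
  refine ⟨φ, hveq, hsle, ?_⟩
  rw [isoperimetricRatio, isoperimetricRatio, hveq]
  exact ENNReal.div_le_div_right hsle _
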